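/- **Theorem.** All Hilbert spaces are finite-dimensional. Let $\mathcal{N}_{A\rightarrow\mathcal{B}\cup\mathcal{E}}$ be a quantum broadcast channel, i.e. a completely positive trace-preserving map from the operators on $A$ to the operators on a finite collection $\mathcal{B}\cup\mathcal{E}$ of systems, where the decoding set $\mathcal{B}$ (held by Bob) and the malicious set $\mathcal{E}$ (held by Eve) may overlap. For $M\in\mathbb{Z}^+$, an $(M,\varepsilon,\delta)$ entanglement-assisted (EA) private code consists of a pre-shared bipartite state $\Psi_{RA'}$, encoding channels $\mathcal{C}^m_{A'\to A}$ and a decoding POVM $\{\Lambda^m_{R\mathcal{B}}\}$, $m\in\{1,\dots,M\}$, such that, with $\rho^m_{R\,\mathcal{B}\cup\mathcal{E}}=\mathcal{N}(\mathcal{C}^m(\Psi_{RA'}))$, one has $\operatorname{Tr}\{(I-\Lambda^m_{R\mathcal{B}})\rho^m_{R\mathcal{B}}\}\le\varepsilon$ for all $m$, and there is a fixed state $\sigma_{R\mathcal{E}}$ with $\frac12\|\rho^m_{R\mathcal{E}}-\sigma_{R\mathcal{E}}\|_1\le\delta$ for all $m$. The one-shot EA private capacity $C_{\rm EP}^{\varepsilon,\delta}(\mathcal{N})$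 is the largest $\log_2 M$ for which an $(M,\varepsilon,\delta)$ code exists. For all $\varepsilon,\delta\in(0,1)$, $$C_{\rm EP}^{\varepsilon,\delta}(\mathcal{N})\ \ge\ \sup_{\rho_{RA},\ \eta_1\in(0,\varepsilon),\ \eta_2\in(0,\delta)}\Big[I_H^{\varepsilon-\eta_1}(R;\mathcal{B})_\omega-\tilde I_{\max}^{\delta-\eta_2}(\mathcal{E};R)_\omega-\log_2\frac{4\varepsilon}{\eta_1^2}-2\log_2\frac1{\eta_2}\Big],$$ where $\rho_{RA}$ is an arbitrary state with an arbitrary reference system $R$ and $\omega_{R\,\mathcal{B}\cup\mathcal{E}}=\mathcal{N}_{A\to\mathcal{B}\cup\mathcal{E}}(\rho_{RA})$. Here $I_H^{\varepsilon}(A;B)_\rho=-\log_2\inf\{\operatorname{Tr}\{\Lambda(\rho_A\otimes\rho_B)\}:0\le\Lambda\le I,\ \operatorname{Tr}\{\Lambda\rho_{AB}\}\ge1-\varepsilon\}$, and $\tilde I_{\max}^{\varepsilon}(B;A)_\rho=\inf_{\rho'}D_{\max}(\rho'_{AB}\|\rho_A\otimes\rho'_B)$, the infimum being over the positive semidefinite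 operators $\rho'_{AB}$ of trace at most one with $P(\rho',\rho)\le\varepsilon$, where $D_{\max}(\omega\|\tau)=\inf\{\lambda\in\mathbb{R}:\omega\le2^\lambda\tau\}$, $P(\rho,\sigma)=\sqrt{1-F(\rho\oplus[1-\operatorname{Tr}\rho],\sigma\oplus[1-\operatorname{Tr}\sigma])}$ and $F(\rho,\sigma)=\|\sqrt\rho\sqrt\sigma\|_1^2$. -/

import Mathlib

open scoped Kronecker ComplexOrder

noncomputable section

namespace EAPrivate

/-! Finite-dimensional Hilbert spaces are represented through an orthonormal basis indexed by a
finite type `a`; operators are the matrices `Matrix a a ℂ`, and `Matrix (a × b) (a × b) ℂ` is the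
space of operators on a tensor product. -/

section Matrices

variable {a b : Type} [Fintype a] [Fintype b] [DecidableEq a] [DecidableEq b]

/-- Density operators: positive semidefinite with unit trace. -/
def IsState (ρ : Matrix a a ℂ) : Prop := ρ.PosSemidef ∧ ρ.trace = 1

/-- Subnormalized density operators: positive semidefinite with trace at most one. -/
def IsSubState (ρ : Matrix a a ℂ) : Prop := ρ.PosSemidef ∧ ρ.trace.re ≤ 1

/-- The partial trace over the second factor. -/
def traceRight (ρ : Matrix (a × b) (a × b) ℂ) : Matrix a a ℂ :=
  fun i j => ∑ k, ρ (i, k) (j, k)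

/-- The partial trace over the first factor. -/
def traceLeft (ρ : Matrix (a × b) (a × b) ℂ) : Matrix b b ℂ :=
  fun i j => ∑ k, ρ (k, i) (k, j)

/-- The positive square root of a positive semidefinite matrix. -/
def psdSqrt (A : Matrix a a ℂ) : Matrix a a ℂ := cfc Real.sqrt A

/-- The trace norm `‖C‖₁ = Tr √(C† C)`. -/
def traceNorm (C : Matrix a a ℂ) : ℝ := (psdSqrt (C.conjTranspose * C)).trace.re

/-- The fidelity `F(ρ, σ) = ‖√ρ √σ‖₁²`. -/
def fidelity (ρ σ : Matrix a a ℂ) : ℝ := traceNorm (psdSqrt ρ * psdSqrt σ) ^ 2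

/-- The normalized extension `ρ ⊕ [1 - Tr ρ]` of a subnormalized density operator. -/
def extend (ρ : Matrix a a ℂ) : Matrix (a ⊕ Unit) (a ⊕ Unit) ℂ :=
  Matrix.fromBlocks ρ 0 0 (fun _ _ => 1 - ρ.trace)

/-- The purified distance `P(ρ, σ) = √(1 - F(ρ ⊕ [1 - Tr ρ], σ ⊕ [1 - Tr σ]))`. -/
def purifiedDist (ρ σ : Matrix a a ℂ) : ℝ := Real.sqrt (1 - fidelity (extend ρ) (extend σ))

/-- The ball of subnormalized states that are `ε`-close to `ρ` in purified distance. -/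
def stateBall (ε : ℝ) (ρ : Matrix a a ℂ) : Set (Matrix a a ℂ) :=
  {ρ' | IsSubState ρ' ∧ purifiedDist ρ' ρ ≤ ε}

/-- `Λ` is a test: `0 ≤ Λ ≤ I`. -/
def IsTest (Λ : Matrix a a ℂ) : Prop := Λ.PosSemidef ∧ (1 - Λ).PosSemidef

/-- The smallest value of `Tr (Λ τ)` over the tests `Λ` with `Tr (Λ ω) ≥ 1 - ε`. -/
def minTypeTwoError (ε : ℝ) (ω τ : Matrix a a ℂ) : ℝ :=
  sInf {x | ∃ Λ : Matrix a a ℂ, IsTest Λ ∧ 1 - ε ≤ (Λ * ω).trace.re ∧ x = (Λ * τ).trace.re}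

/-- The hypothesis testing relative entropy (base 2), equal to `+∞` when the minimal error
vanishes. -/
def hypTestEntropy (ε : ℝ) (ω τ : Matrix a a ℂ) : EReal :=
  if minTypeTwoError ε ω τ = 0 then ⊤ else ((-Real.logb 2 (minTypeTwoError ε ω τ) : ℝ) : EReal)

/-- The max-relative entropy `inf {l ∈ ℝ : ω ≤ 2^l τ}` (equal to `+∞` if there is no such `l`). -/
def maxEntropy (ω τ : Matrix a a ℂ) : EReal :=
  ⨅ (l : ℝ) (_ : ((((2 : ℝ) ^ l : ℝ) : ℂ) • τ - ω).PosSemidef), (l : EReal)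

/-- The hypothesis testing mutual information `I_H^ε(A;B)_ρ = D_H^ε(ρ_AB ‖ ρ_A ⊗ ρ_B)`. -/
def hypTestInfo (ε : ℝ) (ρ : Matrix (a × b) (a × b) ℂ) : EReal :=
  hypTestEntropy ε ρ (traceRight ρ ⊗ₖ traceLeft ρ)

/-- For a state `ρ` of the systems `A B` (in this order), the smoothed max-mutual information
`Ĩ_max^ε(B;A)_ρ = inf {D_max(ρ'_AB ‖ ρ_A ⊗ ρ'_B) : ρ' in the ε-ball around ρ}`. -/
def smoothMaxInfo (ε : ℝ) (ρ : Matrix (a × b) (a × b) ℂ) : EReal :=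
  ⨅ ρ' ∈ stateBall ε ρ, maxEntropy ρ' (traceRight ρ ⊗ₖ traceLeft ρ')

end Matrices

section Channels

/-- The map `id_R ⊗ Φ`. -/
def tensorId {a b : Type} (r : Type) (Φ : Matrix a a ℂ →ₗ[ℂ] Matrix b b ℂ)
    (X : Matrix (r × a) (r × a) ℂ) : Matrix (r × b) (r × b) ℂ :=
  fun i j => Φ (fun x y => X (i.1, x) (j.1, y)) i.2 j.2

/-- Quantum channels: completely positive trace-preserving linear maps. -/
structure Channel (a b : Type) [Fintype a] [Fintype b] where
  map : Matrix a a ℂ →ₗ[ℂ] Matrix b b ℂ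
  completelyPositive : ∀ (k : ℕ) (X : Matrix (Fin k × a) (Fin k × a) ℂ),
    X.PosSemidef → (tensorId (Fin k) map X).PosSemidef
  tracePreserving : ∀ X : Matrix a a ℂ, (map X).trace = X.trace

end Channels

section Broadcast

variable {A ι : Type} [Fintype A] [Fintype ι] [DecidableEq ι]
  {d : ι → Type} [∀ i, Fintype (d i)] [∀ i, DecidableEq (d i)]

/-- For an operator on `R` and the systems `i : ι`, the reduced operator on `R` and the systems
in `S`: all the systems outside `S` are traced out. -/
def marginal {R : Type} (S : Finset ι)
    (ω : Matrix (R × (∀ i, d i)) (R × (∀ i, d i)) ℂ) :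
    Matrix (R × (∀ i : {i // i ∈ S}, d i)) (R × (∀ i : {i // i ∈ S}, d i)) ℂ :=
  fun u v => ∑ z : (∀ i : {i // ¬ i ∈ S}, d i),
    ω (u.1, (Equiv.piEquivPiSubtypeProd (fun i => i ∈ S) d).symm (u.2, z))
      (v.1, (Equiv.piEquivPiSubtypeProd (fun i => i ∈ S) d).symm (v.2, z))

/-- An `(M, ε, δ)` entanglement-assisted private code for the broadcast channel `N` from `A` to
the systems `i : ι`, with decoding set `𝓑` and malicious set `𝓔`. The pre-shared state is on
systems `R` and `A'`, held by the receivers (both Bob and Eve) and by the sender respectively. -/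
structure Code (N : Channel A (∀ i, d i)) (𝓑 𝓔 : Finset ι) (M : ℕ) (ε δ : ℝ)
    (R A' : Type) [Fintype R] [DecidableEq R] [Fintype A'] where
  /-- the pre-shared state -/
  shared : Matrix (R × A') (R × A') ℂ
  shared_isState : IsState shared
  /-- the encoding channels -/
  enc : Fin M → Channel A' A
  /-- the decoding measurement -/
  dec : Fin M → Matrix (R × (∀ i : {i // i ∈ 𝓑}, d i)) (R × (∀ i : {i // i ∈ 𝓑}, d i)) ℂ
  dec_posSemidef : ∀ m, (dec m).PosSemidef
  dec_sum : ∑ m, dec m = 1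
  /-- every message is decoded with error probability at most `ε` -/
  reliable : ∀ m, ((1 - dec m) *
    marginal 𝓑 (tensorId R N.map (tensorId R (enc m).map shared))).trace.re ≤ ε
  /-- every message is `δ`-secure against the malicious party, who holds `R` and `𝓔` -/
  secure : ∃ σ : Matrix (R × (∀ i : {i // i ∈ 𝓔}, d i)) (R × (∀ i : {i // i ∈ 𝓔}, d i)) ℂ,
    IsState σ ∧ ∀ m, (1 / 2 : ℝ) * traceNorm
      (marginal 𝓔 (tensorId R N.map (tensorId R (enc m).map shared)) - σ) ≤ δ

/-- There is an `(M, ε, δ)` code for `N`, with shared systems of arbitrary finite dimension. -/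
def HasCode (N : Channel A (∀ i, d i)) (𝓑 𝓔 : Finset ι) (M : ℕ) (ε δ : ℝ) : Prop :=
  ∃ (R A' : Type) (_ : Fintype R) (_ : DecidableEq R) (_ : Fintype A'),
    Nonempty (Code N 𝓑 𝓔 M ε δ R A')

/-- The one-shot entanglement-assisted private capacity: the largest `log₂ M` such that there is
an `(M, ε, δ)` code. -/
def oneShotCapacity (N : Channel A (∀ i, d i)) (𝓑 𝓔 : Finset ι) (ε δ : ℝ) : EReal :=
  ⨆ (M : ℕ) (_ : 0 < M ∧ HasCode N 𝓑 𝓔 M ε δ), ((Real.logb 2 M : ℝ) : EReal)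

end Broadcast

end EAPrivate

end

/-!
The codes combine position-based coding with convex splitting. Sender and receivers share `M K`
copies of `ρ`; message `m` is sent by putting a uniformly random copy of the `m`-th block of length
`K` through the channel. Writing `ρ_R` for the marginal of `ρ`, the receivers' state is the average
over `k` of `place ρ_R (m, k) ω`: the channel output `ω` at position `(m, k)` of `R^{MK}`, and `ρ_R`
at every other position (`marginal_tensorId_randomSelect`).

*Reliability.* A test that distinguishes `ω` from the product of its marginals, applied at each
position, tells where the correlated copy is. The square-root measurement built from these tests is
controlled by the Hayashi-Nagaoka inequality (`hayashiNagaoka`, `exists_positionDecoder`), which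
gives error at most `ε` as soon as `M K - 1` is below `η₁² / (4 ε)` times the inverse type-two error.

*Secrecy.* Let `ω'` be a smoothing of Eve's state with `ω' ≤ μ (ρ_R ⊗ ω'_E)` and write
`ω' = N G N` with `N² = ρ_R ⊗ ω'_E`. Copies of `G` at different positions are uncorrelated for the
weight `N²`, so their average over `K` positions has variance at most `(μ - 1) / K`, and by
Cauchy-Schwarz the average of `place ρ_R (m, k) ω'` over `k` is within trace distance
`√((μ - 1) / K) / 2` of `ρ_R^{⊗ MK} ⊗ ω'_E` (`convexSplit`). The passage from `ω` to `ω'` and the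
normalization of `ω'_E` cost the generalized trace distance, which the purified distance dominates
(`IsContraction.re_trace_mul_sub_add_le`, from the Fuchs-van de Graaf inequality).
So `K ≥ (μ - 1) / (4 η₂²)` suffices (`exists_reference_state`).

The second-moment estimate gains a factor `4` in `K` over the usual entropic form of the convex
split lemma. This is what absorbs the rounding of `M` and `K` to integers
(`exists_block_sizes`), so that the bound holds exactly for the logarithm of an integer.
-/

set_option linter.unusedSectionVars false

noncomputable section

namespace EAPrivate

/-! ### Matrix preliminaries: positivity, contractions and the polar decomposition -/

section LinearAlgebra

variable {m n : Type} [Fintype m] [Fintype n] [DecidableEq m] [DecidableEq n]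

lemma exists_conjTranspose_mul_self {A : Matrix n n ℂ} (hA : A.PosSemidef) :
    ∃ B : Matrix n n ℂ, A = B.conjTranspose * B := by
  open scoped MatrixOrder in
  exact CStarAlgebra.nonneg_iff_eq_star_mul_self.mp hA.nonneg

lemma re_trace_nonneg {A : Matrix n n ℂ} (hA : A.PosSemidef) : 0 ≤ A.trace.re :=
  (Complex.le_def.mp hA.trace_nonneg).1

lemma re_trace_mul_nonneg {A B : Matrix n n ℂ} (hA : A.PosSemidef) (hB : B.PosSemidef) :
    0 ≤ (A * B).trace.re := by
  obtain ⟨C, rfl⟩ := exists_conjTranspose_mul_self hB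
  rw [← Matrix.mul_assoc, Matrix.trace_mul_comm, ← Matrix.mul_assoc]
  exact re_trace_nonneg (hA.mul_mul_conjTranspose_same C)

lemma re_trace_mul_le {A B W : Matrix n n ℂ} (h : (B - A).PosSemidef) (hW : W.PosSemidef) :
    (A * W).trace.re ≤ (B * W).trace.re := by
  have := re_trace_mul_nonneg h hW
  rw [Matrix.sub_mul, Matrix.trace_sub, Complex.sub_re] at this
  linarith

/-- The Cauchy-Schwarz inequality for the Hilbert-Schmidt inner product. -/
lemma re_trace_conjTranspose_mul_le (A B : Matrix m n ℂ) :
    (A.conjTranspose * B).trace.re ≤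
      √(A.conjTranspose * A).trace.re * √(B.conjTranspose * B).trace.re := by
  let v (X : Matrix m n ℂ) : EuclideanSpace ℂ (n × m) := WithLp.toLp 2 fun p => X p.2 p.1
  have key (X Y : Matrix m n ℂ) : (X.conjTranspose * Y).trace = inner ℂ (v X) (v Y) := by
    simp only [Matrix.trace, Matrix.diag_apply, Matrix.mul_apply, Matrix.conjTranspose_apply, v,
      PiLp.inner_apply, Fintype.sum_prod_type, RCLike.inner_apply]
    exact Finset.sum_congr rfl fun i _ => Finset.sum_congr rfl fun j _ => mul_comm _ _
  have hn (X : Matrix m n ℂ) : √(X.conjTranspose * X).trace.re = ‖v X‖ := by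
    rw [key, norm_eq_sqrt_re_inner (𝕜 := ℂ)]
    rfl
  rw [hn, hn, key]
  exact (Complex.re_le_norm _).trans (norm_inner_le_norm _ _)

/-- Hermitian contractions, in the form `-1 ≤ T ≤ 1`. -/
structure IsContraction (T : Matrix n n ℂ) : Prop where
  one_sub : (1 - T).PosSemidef
  one_add : (1 + T).PosSemidef

namespace IsContraction

variable {T : Matrix n n ℂ}

lemma isHermitian (hT : IsContraction T) : T.IsHermitian := by
  have := hT.one_add.isHermitian.sub (Matrix.isHermitian_one (n := n) (α := ℂ))
  rwa [add_sub_cancel_left] at this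

lemma one_sub_mul_self (hT : IsContraction T) : (1 - T * T).PosSemidef := by
  have h1 := hT.one_sub.conjTranspose_mul_mul_same (1 + T)
  have h2 := hT.one_add.conjTranspose_mul_mul_same (1 - T)
  rw [hT.one_add.isHermitian.eq] at h1
  rw [hT.one_sub.isHermitian.eq] at h2
  have h := (h1.add h2).smul (a := (1 / 2 : ℝ)) (by norm_num)
  convert h using 1
  have : (1 + T) * (1 - T) * (1 + T) + (1 - T) * (1 + T) * (1 - T)
      = (2 : ℝ) • (1 - T * T) := by
    rw [two_smul]; noncomm_ring
  rw [this, smul_smul]; norm_num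

lemma re_trace_mul_le (hT : IsContraction T) {W : Matrix n n ℂ} (hW : W.PosSemidef) :
    (T * W).trace.re ≤ W.trace.re := by
  simpa using EAPrivate.re_trace_mul_le hT.one_sub hW

lemma neg (hT : IsContraction T) : IsContraction (-T) :=
  ⟨by simpa using hT.one_add, by simpa [sub_eq_add_neg] using hT.one_sub⟩

/-- A Hermitian contraction does not increase the Hilbert-Schmidt norm. -/
lemma re_trace_conjTranspose_mul_le (hT : IsContraction T) (X Y : Matrix n n ℂ) :
    (X.conjTranspose * T * Y).trace.re ≤
      √(X.conjTranspose * X).trace.re * √(Y.conjTranspose * Y).trace.re := by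
  have h := EAPrivate.re_trace_conjTranspose_mul_le (T * X) Y
  rw [Matrix.conjTranspose_mul, hT.isHermitian.eq] at h
  refine h.trans (mul_le_mul_of_nonneg_right (Real.sqrt_le_sqrt ?_) (Real.sqrt_nonneg _))
  have := re_trace_nonneg (hT.one_sub_mul_self.conjTranspose_mul_mul_same X)
  rw [Matrix.mul_sub, Matrix.sub_mul, Matrix.trace_sub, Complex.sub_re, Matrix.mul_one] at this
  simp only [Matrix.mul_assoc] at this ⊢
  linarith

end IsContraction

open Matrix in
lemma trace_cfc {A : Matrix n n ℂ} (hA : A.IsHermitian) (f : ℝ → ℝ) :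
    (cfc f A).trace = ∑ i, (f (hA.eigenvalues i) : ℂ) := by
  rw [hA.cfc_eq, IsHermitian.cfc, Unitary.conjStarAlgAut_apply, trace_mul_cycle]
  simp [Matrix.trace]

/-- The unitary factor of the polar decomposition, characterized by attaining the trace norm.
The columns of `C W`, for `W` a unitary diagonalizing `C† C`, are orthogonal; normalizing those
that do not vanish and extending to an orthonormal basis gives the unitary. -/
lemma exists_unitary_trace_mul (C : Matrix n n ℂ) :
    ∃ U : Matrix n n ℂ, U.conjTranspose * U = 1 ∧ U * U.conjTranspose = 1 ∧
      (U * C).trace = (traceNorm C : ℂ) := by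
  have hH := Matrix.isHermitian_conjTranspose_mul_self C
  set d := hH.eigenvalues with hd
  have hd0 (i) : 0 ≤ d i := Matrix.eigenvalues_conjTranspose_mul_self_nonneg C i
  obtain ⟨W, hW⟩ : ∃ W : Matrix n n ℂ, W = hH.eigenvectorUnitary := ⟨_, rfl⟩
  have hWW : W.conjTranspose * W = 1 :=
    hW ▸ Unitary.coe_star_mul_self hH.eigenvectorUnitary
  have hWW' : W * W.conjTranspose = 1 :=
    hW ▸ Unitary.coe_mul_star_self hH.eigenvectorUnitary
  have hdiag : (C * W).conjTranspose * (C * W) = Matrix.diagonal fun i => (d i : ℂ) := by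
    have h := hH.spectral_theorem
    rw [Unitary.conjStarAlgAut_apply, ← hW] at h
    change _ = W * _ * W.conjTranspose at h
    rw [Matrix.conjTranspose_mul, Matrix.mul_assoc, ← Matrix.mul_assoc _ C, h]
    rw [Matrix.mul_assoc, hWW, Matrix.mul_one, ← Matrix.mul_assoc, hWW, Matrix.one_mul]
    rfl
  let c (j : n) : EuclideanSpace ℂ n := WithLp.toLp 2 fun i => (C * W) i j
  have hc (i j) : inner ℂ (c i) (c j) = if i = j then (d i : ℂ) else 0 := by
    have := congrFun (congrFun hdiag i) j
    rw [Matrix.diagonal_apply, Matrix.mul_apply] at this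
    rw [← this, PiLp.inner_apply]
    exact Finset.sum_congr rfl fun k _ => by simp [c, mul_comm]
  have hon : Orthonormal ℂ (({i | d i ≠ 0} : Set n).domRestrict
      fun i => ((√(d i))⁻¹ : ℂ) • c i) := by
    rw [orthonormal_iff_ite]
    rintro ⟨i, hi⟩ ⟨j, hj⟩
    simp only [Set.domRestrict_apply, inner_smul_left, inner_smul_right, hc, Subtype.mk.injEq]
    split_ifs with h
    · subst h
      have h0 : √(d i) ≠ 0 := fun h0 => hi ((Real.sqrt_eq_zero (hd0 i)).mp h0)
      simp only [map_inv₀, Complex.conj_ofReal]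
      norm_cast
      nth_rewrite 3 [← Real.mul_self_sqrt (hd0 i)]
      field_simp
    · simp
  obtain ⟨b, hb⟩ := hon.exists_orthonormalBasis_extension_of_card_eq (by simp)
  have hcb (j) : c j = (√(d j) : ℂ) • b j := by
    by_cases h : d j = 0
    · have : inner ℂ (c j) (c j) = 0 := by rw [hc, if_pos rfl, h, Complex.ofReal_zero]
      rw [inner_self_eq_zero.mp this, h]; simp
    · have h0 : (√(d j) : ℂ) ≠ 0 := by
        exact_mod_cast fun h0 => h ((Real.sqrt_eq_zero (hd0 j)).mp h0)
      rw [hb j h, smul_smul, mul_inv_cancel₀ h0, one_smul]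
  let U₀ : Matrix n n ℂ := fun i j => b j i
  have hU₀ : U₀.conjTranspose * U₀ = 1 := by
    ext i j
    have := orthonormal_iff_ite.mp b.orthonormal i j
    rw [PiLp.inner_apply] at this
    rw [Matrix.mul_apply, Matrix.one_apply, ← this]
    exact Finset.sum_congr rfl fun k _ => by
      rw [Matrix.conjTranspose_apply, RCLike.inner_apply, mul_comm]; rfl
  have hCW : C * W = U₀ * Matrix.diagonal fun i => (√(d i) : ℂ) := by
    ext i j
    rw [Matrix.mul_diagonal]
    have := congrArg (fun v => v.ofLp i) (hcb j)
    simpa [c, U₀, mul_comm] using this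
  have hU₀' := mul_eq_one_comm.mp hU₀
  refine ⟨W * U₀.conjTranspose, ?_, ?_, ?_⟩
  · rw [Matrix.conjTranspose_mul, Matrix.conjTranspose_conjTranspose, Matrix.mul_assoc,
      ← Matrix.mul_assoc _ W, hWW, Matrix.one_mul, hU₀']
  · rw [Matrix.conjTranspose_mul, Matrix.conjTranspose_conjTranspose, Matrix.mul_assoc,
      ← Matrix.mul_assoc _ U₀, hU₀, Matrix.one_mul, hWW']
  · rw [Matrix.mul_assoc, Matrix.trace_mul_comm, Matrix.mul_assoc, hCW, ← Matrix.mul_assoc, hU₀,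
      Matrix.one_mul, traceNorm, psdSqrt, trace_cfc hH]
    simp [Matrix.trace, ← hd, ← Complex.ofReal_sum]

/-- The trace norm of a Hermitian matrix is attained at a Hermitian contraction, the Hermitian part
of its polar unitary. -/
lemma exists_isContraction_traceNorm {H : Matrix n n ℂ} (hH : H.IsHermitian) :
    ∃ T, IsContraction T ∧ (T * H).trace.re = traceNorm H := by
  obtain ⟨U, hU, hU', htr⟩ := exists_unitary_trace_mul H
  have hpos (V : Matrix n n ℂ) (hV : V.conjTranspose * V = 1) :
      (1 - (1 / 2 : ℝ) • (V + V.conjTranspose)).PosSemidef := by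
    have h := (Matrix.posSemidef_conjTranspose_mul_self (1 - V)).smul (a := (1 / 2 : ℝ))
      (by norm_num)
    convert h using 1
    have : (1 - V).conjTranspose * (1 - V) = (2 : ℝ) • 1 - (V + V.conjTranspose) := by
      rw [Matrix.conjTranspose_sub, Matrix.conjTranspose_one, Matrix.sub_mul, Matrix.mul_sub,
        Matrix.mul_sub, hV, two_smul]
      simp only [Matrix.one_mul, Matrix.mul_one]
      abel
    rw [this, smul_sub, smul_smul]
    norm_num
  refine ⟨(1 / 2 : ℝ) • (U + U.conjTranspose), ⟨hpos U hU, ?_⟩, ?_⟩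
  · have := hpos (-U) (by simpa using hU)
    convert this using 1
    rw [Matrix.conjTranspose_neg, ← neg_add, smul_neg, sub_neg_eq_add]
  · have h : (U.conjTranspose * H).trace.re = (U * H).trace.re := by
      have := Matrix.trace_conjTranspose (U * H)
      rw [Matrix.conjTranspose_mul, hH.eq, Matrix.trace_mul_comm] at this
      rw [this]; simp
    rw [Matrix.smul_mul, Matrix.trace_smul, Matrix.add_mul, Matrix.trace_add, Complex.smul_re,
      Complex.add_re, h, htr, Complex.ofReal_re, smul_eq_mul]
    ring

lemma posSemidef_psdSqrt (A : Matrix n n ℂ) : (psdSqrt A).PosSemidef := by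
  open scoped MatrixOrder in
  exact Matrix.nonneg_iff_posSemidef.mp (cfc_nonneg fun x _ => Real.sqrt_nonneg x)

lemma continuousOn_spectrum (A : Matrix n n ℂ) (f : ℝ → ℝ) : ContinuousOn f (spectrum ℝ A) :=
  Set.Finite.continuousOn Matrix.finite_real_spectrum f

lemma cfc_mul_cfc (A : Matrix n n ℂ) (f g : ℝ → ℝ) :
    cfc f A * cfc g A = cfc (fun x => f x * g x) A :=
  (cfc_mul f g A (continuousOn_spectrum A f) (continuousOn_spectrum A g)).symm

lemma nonneg_of_mem_spectrum {A : Matrix n n ℂ} (hA : A.PosSemidef) {x : ℝ}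
    (hx : x ∈ spectrum ℝ A) : 0 ≤ x := by
  open scoped MatrixOrder in
  exact spectrum_nonneg_of_nonneg hA.nonneg hx

lemma psdSqrt_mul_self {A : Matrix n n ℂ} (hA : A.PosSemidef) : psdSqrt A * psdSqrt A = A := by
  rw [psdSqrt, cfc_mul_cfc]
  conv_rhs => rw [← cfc_id' ℝ A hA.isHermitian]
  exact cfc_congr fun x hx => Real.mul_self_sqrt (nonneg_of_mem_spectrum hA hx)

/-- `N` is a Hermitian square root of `A`, and `N'` its Moore-Penrose inverse. -/
structure IsSqrtPinv (A N N' : Matrix n n ℂ) : Prop where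
  isHermitian : N.IsHermitian
  isHermitian' : N'.IsHermitian
  mul_self : N * N = A
  comm : N' * N = N * N'
  mul_mul : N * N' * N = N
  mul_mul' : N' * N * N' = N'

lemma exists_isSqrtPinv {A : Matrix n n ℂ} (hA : A.PosSemidef) :
    ∃ N N', IsSqrtPinv A N N' := by
  refine ⟨psdSqrt A, cfc (fun x => (√x)⁻¹) A, (posSemidef_psdSqrt A).isHermitian,
    cfc_predicate _ A, psdSqrt_mul_self hA, ?_, ?_, ?_⟩ <;>
  simp only [psdSqrt, cfc_mul_cfc] <;> congr 1 <;> ext x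
  · ring
  · exact mul_inv_mul_cancel _
  · simpa using mul_inv_mul_cancel (√x)⁻¹

/-! ### Trace distance, purified distance and the Hayashi-Nagaoka inequality -/

/-- The Fuchs-van de Graaf inequality, tested against a contraction. With `X = √A` and `Y = √B U`,
where the unitary `U` attains `‖√A √B‖₁`, the difference `A - B` is the Hermitian part of
`(X - Y) (X + Y)†`, and the Cauchy-Schwarz inequality applies. -/
lemma IsContraction.re_trace_mul_sub_le {T A B : Matrix n n ℂ} (hT : IsContraction T)
    (hA : IsState A) (hB : IsState B) :
    (T * (A - B)).trace.re ≤ 2 * √(1 - fidelity A B) := by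
  obtain ⟨U, hU, hU', htr⟩ := exists_unitary_trace_mul (psdSqrt A * psdSqrt B)
  set f := traceNorm (psdSqrt A * psdSqrt B) with hf
  have hXh := (posSemidef_psdSqrt A).isHermitian
  have hYh := (posSemidef_psdSqrt B).isHermitian
  have hXX := psdSqrt_mul_self hA.1
  have hYY := psdSqrt_mul_self hB.1
  set X := psdSqrt A
  obtain ⟨Y, hY⟩ : ∃ Y, Y = psdSqrt B * U := ⟨_, rfl⟩
  have hYYh : Y * Y.conjTranspose = B := by
    rw [hY, Matrix.conjTranspose_mul, hYh.eq, Matrix.mul_assoc, ← Matrix.mul_assoc U, hU',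
      Matrix.one_mul, hYY]
  have hXXh : X * X.conjTranspose = A := by rw [hXh.eq, hXX]
  have hxx : (X.conjTranspose * X).trace = 1 := by rw [hXh.eq, hXX, hA.2]
  have hyy : (Y.conjTranspose * Y).trace = 1 := by rw [Matrix.trace_mul_comm, hYYh, hB.2]
  have hxy : (X.conjTranspose * Y).trace = f := by
    rw [hXh.eq, hY, ← Matrix.mul_assoc, Matrix.trace_mul_comm, htr]
  have hyx : (Y.conjTranspose * X).trace = f := by
    have := Matrix.trace_conjTranspose (X.conjTranspose * Y)
    rw [Matrix.conjTranspose_mul, Matrix.conjTranspose_conjTranspose, hxy] at this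
    rw [this]; simp
  have hm : ((X - Y).conjTranspose * (X - Y)).trace.re = 2 - 2 * f := by
    rw [Matrix.conjTranspose_sub, Matrix.sub_mul, Matrix.mul_sub, Matrix.mul_sub, Matrix.trace_sub,
      Matrix.trace_sub, Matrix.trace_sub, hxx, hyy, hxy, hyx]
    simp only [Complex.sub_re, Complex.one_re, Complex.ofReal_re]; ring
  have hp : ((X + Y).conjTranspose * (X + Y)).trace.re = 2 + 2 * f := by
    rw [Matrix.conjTranspose_add, Matrix.add_mul, Matrix.mul_add, Matrix.mul_add, Matrix.trace_add,
      Matrix.trace_add, Matrix.trace_add, hxx, hyy, hxy, hyx]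
    simp only [Complex.add_re, Complex.one_re, Complex.ofReal_re]; ring
  have hcross : (T * (X * Y.conjTranspose)).trace.re = (T * (Y * X.conjTranspose)).trace.re := by
    have := Matrix.trace_conjTranspose (T * (X * Y.conjTranspose))
    rw [Matrix.conjTranspose_mul, Matrix.conjTranspose_mul, Matrix.conjTranspose_conjTranspose,
      hT.isHermitian.eq, Matrix.trace_mul_comm] at this
    rw [this]; simp
  have hexp : (T * (A - B)).trace.re = ((X + Y).conjTranspose * T * (X - Y)).trace.re := by
    rw [Matrix.mul_assoc _ T, Matrix.trace_mul_comm (X + Y).conjTranspose, Matrix.mul_assoc T,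
      Matrix.conjTranspose_add,
      Matrix.sub_mul, Matrix.mul_add, Matrix.mul_add, hXXh, hYYh]
    simp only [Matrix.mul_sub, Matrix.mul_add, Matrix.trace_sub, Matrix.trace_add, Complex.sub_re,
      Complex.add_re, hcross]
    ring
  have hfid : 1 - fidelity A B = 1 - f ^ 2 := rfl
  have hnn : 0 ≤ 2 + 2 * f := hp ▸ re_trace_nonneg (Matrix.posSemidef_conjTranspose_mul_self _)
  rw [hexp, hfid]
  refine (hT.re_trace_conjTranspose_mul_le _ _).trans_eq ?_
  rw [hm, hp, ← Real.sqrt_mul hnn, show (2 + 2 * f) * (2 - 2 * f) = 2 ^ 2 * (1 - f ^ 2) by ring,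
    Real.sqrt_mul (by norm_num), Real.sqrt_sq (by norm_num)]

lemma posSemidef_fromBlocks {A : Matrix m m ℂ} {D : Matrix n n ℂ} (hA : A.PosSemidef)
    (hD : D.PosSemidef) : (Matrix.fromBlocks A 0 0 D).PosSemidef := by
  obtain ⟨B, rfl⟩ := exists_conjTranspose_mul_self hA
  obtain ⟨C, rfl⟩ := exists_conjTranspose_mul_self hD
  have := Matrix.posSemidef_conjTranspose_mul_self (Matrix.fromBlocks B 0 0 C)
  simpa [Matrix.fromBlocks_conjTranspose, Matrix.fromBlocks_multiply] using this

lemma trace_fromBlocks (A : Matrix m m ℂ) (B : Matrix m n ℂ) (C : Matrix n m ℂ)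
    (D : Matrix n n ℂ) : (Matrix.fromBlocks A B C D).trace = A.trace + D.trace := by
  simp [Matrix.trace, Fintype.sum_sum_type]

lemma trace_eq_re {A : Matrix n n ℂ} (hA : A.PosSemidef) : A.trace = (A.trace.re : ℂ) := by
  have := (Complex.le_def.mp hA.trace_nonneg).2
  apply Complex.ext <;> simp_all

lemma IsState.isSubState {ρ : Matrix n n ℂ} (hρ : IsState ρ) : IsSubState ρ :=
  ⟨hρ.1, by simp [hρ.2]⟩

lemma extend_eq (ρ : Matrix n n ℂ) :
    extend ρ = Matrix.fromBlocks ρ 0 0 (Matrix.of fun _ _ => 1 - ρ.trace) := rfl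

lemma isState_extend {ρ : Matrix n n ℂ} (hρ : IsSubState ρ) : IsState (extend ρ) := by
  refine ⟨posSemidef_fromBlocks hρ.1 ?_, ?_⟩
  · have h : (fun _ _ => 1 - ρ.trace : Matrix Unit Unit ℂ)
        = Matrix.diagonal fun _ => ((1 - ρ.trace.re : ℝ) : ℂ) := by
      ext i j
      rw [trace_eq_re hρ.1]; simp
    rw [h]
    refine Matrix.PosSemidef.diagonal fun _ => ?_
    exact Complex.zero_le_real.mpr (sub_nonneg.mpr hρ.2)
  · rw [extend_eq, trace_fromBlocks]
    simp [Matrix.trace]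

/-- The purified distance dominates the generalized trace distance, which accounts for the
missing trace of the subnormalized operator. -/
lemma IsContraction.re_trace_mul_sub_add_le {T ω ω' : Matrix n n ℂ} (hT : IsContraction T)
    (hω : IsState ω) (hω' : IsSubState ω') :
    (T * (ω - ω')).trace.re + (1 - ω'.trace.re) ≤ 2 * purifiedDist ω' ω := by
  have hT' : IsContraction (Matrix.fromBlocks (-T) 0 0 (1 : Matrix Unit Unit ℂ)) := by
    have h1 : (1 : Matrix (n ⊕ Unit) (n ⊕ Unit) ℂ) = Matrix.fromBlocks 1 0 0 1 :=
      Matrix.fromBlocks_one.symm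
    constructor
    · rw [h1, sub_eq_add_neg, Matrix.fromBlocks_neg, Matrix.fromBlocks_add]
      simpa using posSemidef_fromBlocks hT.one_add Matrix.PosSemidef.zero
    · rw [h1, Matrix.fromBlocks_add]
      simpa [← sub_eq_add_neg] using posSemidef_fromBlocks hT.one_sub
        (Matrix.PosSemidef.one.add Matrix.PosSemidef.one)
  refine le_of_eq_of_le ?_
    (hT'.re_trace_mul_sub_le (isState_extend hω') (isState_extend hω.isSubState))
  have h2 : extend ω' - extend ω = Matrix.fromBlocks (ω' - ω) 0 0
      (Matrix.of fun _ _ => ω.trace - ω'.trace) := by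
    ext i j
    rcases i with i | i <;> rcases j with j | j <;> simp [extend_eq]
  rw [h2, Matrix.fromBlocks_multiply, trace_fromBlocks]
  have h3 : -T * (ω' - ω) = T * (ω - ω') := by noncomm_ring
  have h4 : (Matrix.of fun _ _ => ω.trace - ω'.trace : Matrix Unit Unit ℂ).trace
      = 1 - ω'.trace := by simp [Matrix.trace, ← hω.2]
  rw [h3, Matrix.one_mul, Matrix.mul_zero, Matrix.mul_zero, add_zero, zero_add, h4]
  simp

/-- A matrix between `0` and `1` is below the square root of any matrix that dominates it. -/
lemma posSemidef_psdSqrt_sub {Λ S : Matrix n n ℂ} (hΛ : IsTest Λ) (hS : (S - Λ).PosSemidef) :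
    (psdSqrt S - Λ).PosSemidef := by
  have h1 : (S - Λ * Λ).PosSemidef := by
    have hc : IsContraction (1 - (2 : ℝ) • Λ) := by
      constructor
      · simpa using hΛ.1.smul (a := (2 : ℝ)) (by norm_num)
      · convert hΛ.2.smul (a := (2 : ℝ)) (by norm_num) using 1
        rw [smul_sub, two_smul, two_smul]; abel
    have h2 := (hc.one_sub_mul_self.smul (a := (1 / 4 : ℝ)) (by norm_num)).add hS
    have : 1 - (1 - (2 : ℝ) • Λ) * (1 - (2 : ℝ) • Λ) = (4 : ℝ) • (Λ - Λ * Λ) := by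
      rw [show (4 : ℝ) = 2 + 2 by norm_num, add_smul, two_smul, two_smul]; noncomm_ring
    rw [this, smul_smul] at h2
    norm_num at h2
    exact h2
  open scoped MatrixOrder Matrix.Norms.L2Operator in
  have h0 : (0 : Matrix n n ℂ) ≤ Λ := hΛ.1.nonneg
  have h4 : (0 : Matrix n n ℂ) ≤ S := le_trans h0 (Matrix.le_iff.mpr hS)
  have h3 := CFC.sqrt_le_sqrt _ _ (Matrix.le_iff.mpr h1)
  rw [CFC.sqrt_mul_self Λ h0, CFC.sqrt_eq_real_sqrt S h4, cfcₙ_eq_cfc] at h3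
  exact Matrix.le_iff.mp h3

/-- The Hayashi-Nagaoka inequality for an invertible normalization `S = Λ + T`. Since
`1 - X Λ X = X T X` with `X = S^{-1/2}`, splitting `X = (X - 1) + 1` leaves
`(X - 1) T (X - 1) ≤ (X - 1) S (X - 1) = 1 + S - 2 √S`, and `√S ≥ Λ`. -/
lemma hayashiNagaoka {Λ T : Matrix n n ℂ} (hΛ : IsTest Λ) (hT : T.PosSemidef)
    {X : Matrix n n ℂ} (hX : X.IsHermitian) (hXS : X * psdSqrt (Λ + T) = 1) {c : ℝ} (hc : 0 < c) :
    ((1 + c) • (1 - Λ) + (2 + c + c⁻¹) • T - (1 - X * Λ * X)).PosSemidef := by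
  have hS : (Λ + T).PosSemidef := hΛ.1.add hT
  have hR := posSemidef_psdSqrt_sub hΛ (S := Λ + T) (by simpa using hT)
  have hRR := psdSqrt_mul_self hS
  set R := psdSqrt (Λ + T)
  have hRX : R * X = 1 := mul_eq_one_comm.mp hXS
  have h1 := (hΛ.1.conjTranspose_mul_mul_same (X - 1)).smul (a := 1 + c) (by positivity)
  have h2 := (hT.conjTranspose_mul_mul_same (c • (X - 1) - 1)).smul (a := c⁻¹) (by positivity)
  have h3 := hR.smul (a := 2 * (1 + c)) (by positivity)
  have e1 : (X - 1).conjTranspose = X - 1 := by simp [hX.eq]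
  have e2 : (c • (X - 1) - 1).conjTranspose = c • (X - 1) - 1 := by
    simp [Matrix.conjTranspose_smul, hX.eq]
  rw [e1] at h1
  rw [e2] at h2
  have e3 : X * Λ * X + X * T * X = 1 := by
    rw [← Matrix.add_mul, ← Matrix.mul_add, ← hRR, ← Matrix.mul_assoc, hXS, Matrix.one_mul, hRX]
  have e4 : X * Λ + X * T = R := by
    rw [← Matrix.mul_add, ← hRR, ← Matrix.mul_assoc, hXS, Matrix.one_mul]
  have e5 : Λ * X + T * X = R := by
    rw [← Matrix.add_mul, ← hRR, Matrix.mul_assoc, hRX, Matrix.mul_one]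
  convert (h1.add h2).add h3 using 1
  have t1 : X * Λ * X = 1 - X * T * X := eq_sub_of_add_eq e3
  have t2 : X * Λ = R - X * T := eq_sub_of_add_eq e4
  have t3 : Λ * X = R - T * X := eq_sub_of_add_eq e5
  have hc' : c ≠ 0 := hc.ne'
  have s1 : (X - 1) * Λ * (X - 1) = 1 - X * T * X - (R - X * T) - (R - T * X) + Λ := by
    rw [← t1, ← t2, ← t3]; noncomm_ring
  have s2 : (c • (X - 1) - 1) * T * (c • (X - 1) - 1)
      = (c * c) • (X * T * X - X * T - T * X + T) - c • (X * T + T * X - 2 • T) + T := by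
    simp only [Matrix.sub_mul, Matrix.mul_sub, Matrix.smul_mul, Matrix.mul_smul, Matrix.one_mul,
      Matrix.mul_one, smul_sub, smul_add, smul_smul, two_smul]
    abel
  rw [s1, s2, t1]
  match_scalars <;> field_simp <;> ring

end LinearAlgebra

/-! ### Tensor powers, partial traces and operators at a given position -/

section PiKron

variable {I r : Type} [Fintype I] [DecidableEq I] [Fintype r] [DecidableEq r]

/-- The tensor power `C^{⊗ I}`, as a matrix on the functions `I → r`. -/
def piKron (I : Type) [Fintype I] {r : Type} (C : Matrix r r ℂ) : Matrix (I → r) (I → r) ℂ :=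
  Matrix.of fun x y => ∏ j, C (x j) (y j)

lemma piKron_apply (C : Matrix r r ℂ) (x y : I → r) : piKron I C x y = ∏ j, C (x j) (y j) := rfl

lemma piKron_mul (A B : Matrix r r ℂ) : piKron I (A * B) = piKron I A * piKron I B := by
  ext x y
  simp only [piKron_apply, Matrix.mul_apply, Fintype.prod_sum, Finset.prod_mul_distrib]

lemma piKron_one : piKron I (1 : Matrix r r ℂ) = 1 := by
  ext x y
  simp only [piKron_apply, Matrix.one_apply, Finset.prod_ite_zero, Finset.mem_univ, true_imp_iff,
    Finset.prod_const_one, funext_iff]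

lemma piKron_conjTranspose (C : Matrix r r ℂ) :
    piKron I C.conjTranspose = (piKron I C).conjTranspose := by
  ext x y
  simp [piKron_apply, Matrix.conjTranspose_apply]

lemma trace_piKron (C : Matrix r r ℂ) : (piKron I C).trace = C.trace ^ Fintype.card I := by
  simp only [Matrix.trace, Matrix.diag_apply, piKron_apply]
  rw [← Fintype.prod_sum fun (_ : I) a => C a a]
  simp

lemma posSemidef_piKron {C : Matrix r r ℂ} (hC : C.PosSemidef) : (piKron I C).PosSemidef := by
  obtain ⟨B, rfl⟩ := exists_conjTranspose_mul_self hC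
  rw [piKron_mul, piKron_conjTranspose]
  exact Matrix.posSemidef_conjTranspose_mul_self _

lemma isState_piKron {ρ : Matrix r r ℂ} (hρ : IsState ρ) : IsState (piKron I ρ) :=
  ⟨posSemidef_piKron hρ.1, by rw [trace_piKron, hρ.2, one_pow]⟩

end PiKron

section PartialTrace

variable {a b : Type} [Fintype a] [Fintype b] [DecidableEq a] [DecidableEq b]

lemma trace_traceLeft (W : Matrix (a × b) (a × b) ℂ) : (traceLeft W).trace = W.trace := by
  simp only [Matrix.trace, Matrix.diag_apply, traceLeft, Fintype.sum_prod_type_right]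

lemma trace_traceRight (W : Matrix (a × b) (a × b) ℂ) : (traceRight W).trace = W.trace := by
  simp only [Matrix.trace, Matrix.diag_apply, traceRight, Fintype.sum_prod_type]

lemma posSemidef_traceLeft {W : Matrix (a × b) (a × b) ℂ} (hW : W.PosSemidef) :
    (traceLeft W).PosSemidef := by
  have : traceLeft W = ∑ k, W.submatrix (fun i => (k, i)) (fun i => (k, i)) := by
    ext i j; simp [traceLeft, Matrix.sum_apply]
  rw [this]
  exact Matrix.posSemidef_sum _ fun k _ => hW.submatrix _

lemma posSemidef_traceRight {W : Matrix (a × b) (a × b) ℂ} (hW : W.PosSemidef) :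
    (traceRight W).PosSemidef := by
  have : traceRight W = ∑ k, W.submatrix (fun i => (i, k)) (fun i => (i, k)) := by
    ext i j; simp [traceRight, Matrix.sum_apply]
  rw [this]
  exact Matrix.posSemidef_sum _ fun k _ => hW.submatrix _

lemma traceRight_sub (V W : Matrix (a × b) (a × b) ℂ) :
    traceRight (V - W) = traceRight V - traceRight W := by
  ext i j; simp [traceRight]

lemma traceRight_add (V W : Matrix (a × b) (a × b) ℂ) :
    traceRight (V + W) = traceRight V + traceRight W := by
  ext i j; simp [traceRight, Finset.sum_add_distrib]

lemma traceRight_kronecker (A : Matrix a a ℂ) (B : Matrix b b ℂ) :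
    traceRight (A ⊗ₖ B) = B.trace • A := by
  ext i j; simp [traceRight, Matrix.trace, ← Finset.mul_sum, mul_comm]

lemma trace_kronecker_one_mul (W : Matrix a a ℂ) (Y : Matrix (a × b) (a × b) ℂ) :
    ((W ⊗ₖ (1 : Matrix b b ℂ)) * Y).trace = (W * traceRight Y).trace := by
  simp only [Matrix.trace, Matrix.diag_apply, Matrix.mul_apply, Fintype.sum_prod_type, traceRight,
    Matrix.kroneckerMap_apply, Matrix.one_apply, mul_ite, mul_one, mul_zero, ite_mul, zero_mul,
    Finset.sum_ite_eq, Finset.mem_univ, if_true, Finset.mul_sum]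
  exact Finset.sum_congr rfl fun i _ => Finset.sum_comm

lemma traceLeft_one_kronecker_mul (Q : Matrix b b ℂ) (Y : Matrix (a × b) (a × b) ℂ) :
    traceLeft (((1 : Matrix a a ℂ) ⊗ₖ Q) * Y) = Q * traceLeft Y := by
  ext i j
  simp only [traceLeft, Matrix.mul_apply, Fintype.sum_prod_type, Matrix.kroneckerMap_apply,
    Matrix.one_apply, ite_mul, one_mul, zero_mul, Finset.mul_sum]
  rw [Finset.sum_comm (s := Finset.univ (α := b))]
  refine Finset.sum_congr rfl fun k _ => ?_
  rw [Finset.sum_comm]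
  simp

lemma traceLeft_mul_one_kronecker (Q : Matrix b b ℂ) (Y : Matrix (a × b) (a × b) ℂ) :
    traceLeft (Y * ((1 : Matrix a a ℂ) ⊗ₖ Q)) = traceLeft Y * Q := by
  ext i j
  simp only [traceLeft, Matrix.mul_apply, Fintype.sum_prod_type, Matrix.kroneckerMap_apply,
    Matrix.one_apply, ite_mul, one_mul, zero_mul, Finset.sum_mul, mul_ite, mul_zero]
  rw [Finset.sum_comm (s := Finset.univ (α := b))]
  refine Finset.sum_congr rfl fun k _ => ?_
  rw [Finset.sum_comm]
  simp

lemma traceLeft_kronecker_one_mul_comm (P : Matrix a a ℂ) (Y : Matrix (a × b) (a × b) ℂ) :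
    traceLeft ((P ⊗ₖ (1 : Matrix b b ℂ)) * Y) = traceLeft (Y * (P ⊗ₖ (1 : Matrix b b ℂ))) := by
  ext i j
  simp only [traceLeft, Matrix.mul_apply, Fintype.sum_prod_type, Matrix.kroneckerMap_apply,
    Matrix.one_apply, mul_ite, mul_one, mul_zero, ite_mul, zero_mul,
    Finset.sum_ite_eq, Finset.sum_ite_eq', Finset.mem_univ, if_true]
  rw [Finset.sum_comm]
  exact Finset.sum_congr rfl fun k _ => Finset.sum_congr rfl fun l _ => mul_comm _ _

/-- Pairing a contraction with `W ⊗ θ`, for a fixed state `θ`, is pairing some contraction with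
`W`. -/
lemma IsContraction.exists_trace_mul_kronecker {T : Matrix (a × b) (a × b) ℂ}
    (hT : IsContraction T) {θ : Matrix b b ℂ} (hθ : IsState θ) :
    ∃ T' : Matrix a a ℂ, IsContraction T' ∧
      ∀ W : Matrix a a ℂ, (T * (W ⊗ₖ θ)).trace = (T' * W).trace := by
  obtain ⟨B, hB⟩ := exists_conjTranspose_mul_self hθ.1
  let V : Matrix (a × b) (a × b) ℂ := (1 : Matrix a a ℂ) ⊗ₖ B
  let f (T : Matrix (a × b) (a × b) ℂ) := traceRight (V * T * V.conjTranspose)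
  have hf1 : f 1 = 1 := by
    simp only [f, V, Matrix.mul_one, Matrix.conjTranspose_kronecker, ← Matrix.mul_kronecker_mul,
      traceRight_kronecker, Matrix.conjTranspose_one]
    rw [Matrix.trace_mul_comm, ← hB, hθ.2, one_smul]
  have hf (T) (hT : T.PosSemidef) : (f T).PosSemidef :=
    posSemidef_traceRight (hT.mul_mul_conjTranspose_same _)
  refine ⟨f T, ⟨?_, ?_⟩, fun W => ?_⟩
  · have := hf _ hT.one_sub
    rwa [show f (1 - T) = f 1 - f T by simp [f, mul_sub, sub_mul, traceRight_sub], hf1] at this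
  · have := hf _ hT.one_add
    rwa [show f (1 + T) = f 1 + f T by simp [f, mul_add, add_mul, traceRight_add], hf1] at this
  · have h : W ⊗ₖ θ = V.conjTranspose * (W ⊗ₖ 1) * V := by
      simp only [V, Matrix.conjTranspose_kronecker, ← Matrix.mul_kronecker_mul, hB,
        Matrix.conjTranspose_one, Matrix.one_mul, Matrix.mul_one]
    rw [h, ← Matrix.mul_assoc, Matrix.trace_mul_comm, Matrix.trace_mul_comm (f T),
      ← trace_kronecker_one_mul, Matrix.trace_mul_comm (W ⊗ₖ 1)]
    simp only [Matrix.mul_assoc]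

end PartialTrace

section Place

variable {I r b : Type} [Fintype I] [DecidableEq I] [Fintype r] [DecidableEq r]
  [Fintype b] [DecidableEq b]

/-- Splitting off the `k`-th of the systems `I → r`, grouped together with `b`. -/
def placeEquiv (k : I) : (I → r) × b ≃ (r × b) × ({j // j ≠ k} → r) :=
  ((Equiv.funSplitAt k r).prodCongr (Equiv.refl b)).trans
    (Equiv.prodAssoc _ _ _ |>.trans ((Equiv.refl r).prodCongr (Equiv.prodComm _ _)) |>.trans
      (Equiv.prodAssoc _ _ _).symm)

@[simp] lemma placeEquiv_apply (k : I) (p : (I → r) × b) :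
    placeEquiv k p = ((p.1 k, p.2), fun j => p.1 j.1) := rfl

/-- The operator on `r^I ⊗ b` that is `W` on the `k`-th copy of `r` together with `b`, and `C` on
every other copy of `r`. -/
def place (C : Matrix r r ℂ) (k : I) (W : Matrix (r × b) (r × b) ℂ) :
    Matrix ((I → r) × b) ((I → r) × b) ℂ :=
  (W ⊗ₖ piKron {j // j ≠ k} C).submatrix (placeEquiv k) (placeEquiv k)

lemma place_apply (C : Matrix r r ℂ) (k : I) (W : Matrix (r × b) (r × b) ℂ)
    (p q : (I → r) × b) : place C k W p q =
      W (p.1 k, p.2) (q.1 k, q.2) * ∏ j : {j // j ≠ k}, C (p.1 j.1) (q.1 j.1) := rfl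

lemma place_mul (C C' : Matrix r r ℂ) (k : I) (W W' : Matrix (r × b) (r × b) ℂ) :
    place C k W * place C' k W' = place (C * C') k (W * W') := by
  rw [place, place, place, Matrix.submatrix_mul_equiv, ← Matrix.mul_kronecker_mul, piKron_mul]

lemma place_sub (C : Matrix r r ℂ) (k : I) (V W : Matrix (r × b) (r × b) ℂ) :
    place C k (V - W) = place C k V - place C k W := by
  ext p q; simp [place_apply, sub_mul]

lemma place_one (k : I) : place 1 k (1 : Matrix (r × b) (r × b) ℂ) = 1 := by
  rw [place, piKron_one, Matrix.one_kronecker_one, Matrix.submatrix_one_equiv]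

lemma posSemidef_place {C : Matrix r r ℂ} (hC : C.PosSemidef) (k : I)
    {W : Matrix (r × b) (r × b) ℂ} (hW : W.PosSemidef) : (place C k W).PosSemidef :=
  (hW.kronecker (posSemidef_piKron hC)).submatrix _

lemma trace_submatrix_equiv {m n : Type} [Fintype m] [Fintype n] (e : m ≃ n) (A : Matrix n n ℂ) :
    (A.submatrix e e).trace = A.trace :=
  Fintype.sum_equiv e _ _ fun _ => rfl

lemma trace_place {ρ : Matrix r r ℂ} (hρ : IsState ρ) (k : I) (W : Matrix (r × b) (r × b) ℂ) :
    (place ρ k W).trace = W.trace := by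
  rw [place, trace_submatrix_equiv, Matrix.trace_kronecker, (isState_piKron hρ).2, mul_one]

lemma place_kronecker (C : Matrix r r ℂ) (k : I) (Q : Matrix b b ℂ) :
    place C k (C ⊗ₖ Q) = piKron I C ⊗ₖ Q := by
  ext p q
  simp only [place_apply, Matrix.kroneckerMap_apply, piKron_apply]
  rw [Fintype.prod_eq_mul_prod_subtype_ne _ k]
  ring

lemma isTest_place {Λ : Matrix (r × b) (r × b) ℂ} (hΛ : IsTest Λ) (k : I) :
    IsTest (place 1 k Λ) :=
  ⟨posSemidef_place .one k hΛ.1, by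
    rw [← place_one k, ← place_sub]; exact posSemidef_place .one k hΛ.2⟩

lemma trace_place_mul_place_self {ρ : Matrix r r ℂ} (hρ : IsState ρ) (k : I)
    (W W' : Matrix (r × b) (r × b) ℂ) :
    (place ρ k W * place 1 k W').trace = (W * W').trace := by
  rw [place_mul, Matrix.mul_one, trace_place hρ]

/-- Operators at different positions see each other only through the marginal on `b`. -/
lemma trace_place_mul_place_of_ne {ρ : Matrix r r ℂ} (hρ : IsState ρ) {k l : I} (hkl : k ≠ l)
    (W W' : Matrix (r × b) (r × b) ℂ) :
    (place ρ k W * place 1 l W').trace = ((ρ ⊗ₖ traceLeft W) * W').trace := by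
  -- averaging out every copy but the `l`-th leaves `ρ` there, and the marginal of `W` on `b`
  have h : traceRight ((place ρ k W).submatrix (placeEquiv l).symm (placeEquiv l).symm)
      = ρ ⊗ₖ traceLeft W := by
    ext ⟨x, e⟩ ⟨y, f⟩
    have hval (x : r) (e : b) (z : {j // j ≠ l} → r) :
        (placeEquiv l).symm ((x, e), z) = (fun j => if h : j = l then x else z ⟨j, h⟩, e) := by
      rw [Equiv.symm_apply_eq]
      ext j
      · simp
      · rfl
      · rename_i j
        simp [j.2]
    let k' : {j // j ≠ l} := ⟨k, hkl⟩
    let l' : {j // j ≠ k} := ⟨l, hkl.symm⟩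
    let g (j : {j // j ≠ l}) (c : r) : ℂ := if j = k' then W (c, e) (c, f) else ρ c c
    have hterm (z : {j // j ≠ l} → r) : (place ρ k W).submatrix (placeEquiv l).symm
        (placeEquiv l).symm ((x, e), z) ((y, f), z) = ρ x y * ∏ j, g j (z j) := by
      rw [Matrix.submatrix_apply, place_apply, hval, hval,
        Fintype.prod_eq_mul_prod_subtype_ne _ l', Fintype.prod_eq_mul_prod_subtype_ne _ k']
      have hprod : (∏ j : {j : {j // j ≠ k} // j ≠ l'},
            ρ (if h : (j : I) = l then x else z ⟨j, h⟩) (if h : (j : I) = l then y else z ⟨j, h⟩))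
          = ∏ j : {j : {j // j ≠ l} // j ≠ k'}, g j (z j) := by
        refine Fintype.prod_equiv ⟨fun j => ⟨⟨j.1.1, fun h => j.2 (Subtype.ext h)⟩,
            fun h => j.1.2 (congrArg Subtype.val h)⟩,
          fun j => ⟨⟨j.1.1, fun h => j.2 (Subtype.ext h)⟩,
            fun h => j.1.2 (congrArg Subtype.val h)⟩, fun _ => rfl, fun _ => rfl⟩ _ _ fun j => ?_
        have h1 : (j : I) ≠ l := fun h => j.2 (Subtype.ext h)
        have h2 : (⟨j, h1⟩ : {j // j ≠ l}) ≠ k' := fun h => j.1.2 (congrArg Subtype.val h)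
        simp only [h1, dite_false, g, Equiv.coe_fn_mk, h2, if_false]
      simp only at hprod ⊢
      rw [hprod]
      simp only [g, if_true, l', k', hkl, dite_false, dite_true]
      ring
    rw [traceRight]
    simp_rw [hterm]
    rw [← Finset.mul_sum, ← Fintype.prod_sum, Fintype.prod_eq_mul_prod_subtype_ne _ k',
      Finset.prod_eq_one]
    · simp [g, traceLeft]
    · intro j _
      simp only [g, j.2, if_false]
      exact hρ.2
  rw [← h, Matrix.trace_mul_comm, Matrix.trace_mul_comm _ W', ← trace_kronecker_one_mul,
    ← trace_submatrix_equiv (placeEquiv l).symm,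
    ← Matrix.submatrix_mul_equiv _ _ _ (placeEquiv l).symm, place, piKron_one, Matrix.submatrix_submatrix]
  simp

end Place

/-! ### The convex split lemma in trace norm -/

section Variance

variable {n κ : Type} [Fintype n] [DecidableEq n] [Fintype κ] [DecidableEq κ] [Nonempty κ]

/-- A variance bound: if the `G k` all have mean `t` and are pairwise uncorrelated with respect to
the weight `N N`, then `N (avg G - 1) N` has trace norm of order `|κ|^{-1/2}`. -/
lemma re_trace_mul_average_sub_le {T N : Matrix n n ℂ} (hT : IsContraction T)
    (hN : N.IsHermitian) {G : κ → Matrix n n ℂ} (hG : ∀ k, (G k).IsHermitian) {t μ : ℝ}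
    (h0 : (N * N).trace.re = t) (h1 : ∀ k, (N * G k * N).trace.re = t)
    (h2 : ∀ k l, k ≠ l → (N * (G k * G l) * N).trace.re = t)
    (h3 : ∀ k, (N * (G k * G k) * N).trace.re ≤ μ * t) :
    (T * ((Fintype.card κ : ℝ)⁻¹ • ∑ k, N * G k * N - N * N)).trace.re ≤
      √t * √((μ - 1) * t / Fintype.card κ) := by
  set K : ℝ := (Fintype.card κ : ℝ) with hK
  have hK0 : 0 < K := by rw [hK]; exact_mod_cast Fintype.card_pos
  set S := ∑ k, G k with hS
  have hSh : S.IsHermitian := by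
    rw [Matrix.IsHermitian, hS, Matrix.conjTranspose_sum]
    exact Finset.sum_congr rfl fun k _ => (hG k).eq
  obtain ⟨D, hD⟩ : ∃ D, D = K⁻¹ • S - 1 := ⟨_, rfl⟩
  have hDh : D.conjTranspose = D := by
    rw [hD, Matrix.conjTranspose_sub, Matrix.conjTranspose_smul, hSh.eq]; simp
  have hsum : ∑ k, N * G k * N = N * S * N := by
    rw [hS, Finset.mul_sum, Finset.sum_mul]
  have hNDN : K⁻¹ • ∑ k, N * G k * N - N * N = N * D * N := by
    rw [hsum, hD, mul_sub, sub_mul, mul_smul_comm, smul_mul_assoc, mul_one]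
  have hcs := hT.re_trace_conjTranspose_mul_le N (N * D)
  rw [hN.eq, h0, Matrix.conjTranspose_mul, hN.eq, hDh] at hcs
  have htr : (T * (N * D * N)).trace = (N * T * (N * D)).trace := by
    rw [← Matrix.mul_assoc T, Matrix.trace_mul_comm _ N]
    simp only [Matrix.mul_assoc]
  have hvar : (D * N * (N * D)).trace.re ≤ (μ - 1) * t / K := by
    have e1 : (D * N * (N * D)).trace = (N * (D * D) * N).trace := by
      rw [Matrix.mul_assoc D, Matrix.trace_mul_comm D, ← Matrix.mul_assoc, Matrix.mul_assoc _ D,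
        Matrix.mul_assoc, Matrix.trace_mul_comm]
    have e2 : N * (D * D) * N = (K⁻¹ * K⁻¹) • ∑ k, ∑ l, N * (G k * G l) * N
        - (2 * K⁻¹) • ∑ k, N * G k * N + N * N := by
      have : ∑ k, ∑ l, N * (G k * G l) * N = N * (S * S) * N := by
        rw [hS, Finset.sum_mul_sum, Finset.mul_sum, Finset.sum_mul]
        refine Finset.sum_congr rfl fun k _ => ?_
        rw [Finset.mul_sum, Finset.sum_mul]
      rw [this, hsum, hD]
      simp only [mul_sub, sub_mul, mul_smul_comm, smul_mul_assoc, mul_one, one_mul,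
        Matrix.mul_assoc]
      module
    rw [e1, e2]
    simp only [Matrix.trace_add, Matrix.trace_sub, Matrix.trace_smul, Matrix.trace_sum,
      Complex.add_re, Complex.sub_re, Complex.smul_re, Complex.re_sum, h0, h1, smul_eq_mul,
      Finset.sum_const, Finset.card_univ, nsmul_eq_mul]
    have e3 : ∑ k, ∑ l, (N * (G k * G l) * N).trace.re ≤ K * (K * t + (μ - 1) * t) := by
      have (k : κ) : ∑ l, (N * (G k * G l) * N).trace.re ≤ K * t + (μ - 1) * t := by
        rw [← Finset.add_sum_erase _ _ (Finset.mem_univ k)]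
        rw [Finset.sum_congr rfl fun l hl => h2 k l (Finset.ne_of_mem_erase hl).symm,
          Finset.sum_const, Finset.card_erase_of_mem (Finset.mem_univ k), Finset.card_univ,
          nsmul_eq_mul, Nat.cast_sub Fintype.card_pos, ← hK]
        push_cast
        linarith [h3 k]
      refine (Finset.sum_le_sum fun k _ => this k).trans_eq ?_
      rw [Finset.sum_const, Finset.card_univ, nsmul_eq_mul]
    rw [← hK]
    calc _ ≤ K⁻¹ * K⁻¹ * (K * (K * t + (μ - 1) * t)) - 2 * K⁻¹ * (K * t) + t := by gcongr
      _ = _ := by field_simp; ring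
  rw [hNDN, htr]
  exact hcs.trans (by gcongr)

end Variance

section ConvexSplit

variable {n m : Type} [Fintype n] [DecidableEq n] [Fintype m] [DecidableEq m]

lemma IsSqrtPinv.kronecker {A N N' : Matrix m m ℂ} {B M M' : Matrix n n ℂ}
    (hA : IsSqrtPinv A N N') (hB : IsSqrtPinv B M M') :
    IsSqrtPinv (A ⊗ₖ B) (N ⊗ₖ M) (N' ⊗ₖ M') := by
  constructor
  · rw [Matrix.IsHermitian, Matrix.conjTranspose_kronecker, hA.isHermitian.eq, hB.isHermitian.eq]
  · rw [Matrix.IsHermitian, Matrix.conjTranspose_kronecker, hA.isHermitian'.eq, hB.isHermitian'.eq]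
  · rw [← Matrix.mul_kronecker_mul, hA.mul_self, hB.mul_self]
  · rw [← Matrix.mul_kronecker_mul, ← Matrix.mul_kronecker_mul, hA.comm, hB.comm]
  · rw [← Matrix.mul_kronecker_mul, ← Matrix.mul_kronecker_mul, hA.mul_mul, hB.mul_mul]
  · rw [← Matrix.mul_kronecker_mul, ← Matrix.mul_kronecker_mul, hA.mul_mul', hB.mul_mul']

section

variable {τ N N' W : Matrix n n ℂ} (hτ : IsSqrtPinv τ N N') (hW : W.PosSemidef) {μ : ℝ}

include hτ in
lemma IsSqrtPinv.conjTranspose_proj : (N * N').conjTranspose = N * N' := by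
  rw [Matrix.conjTranspose_mul, hτ.isHermitian.eq, hτ.isHermitian'.eq, hτ.comm]

include hτ hW

/-- An operator dominated by a multiple of `τ` lives on the support of `τ`, so it is recovered from
its relative density `N' W N'`. -/
lemma IsSqrtPinv.mul_density_mul (hle : ((μ : ℂ) • τ - W).PosSemidef) :
    N * (N' * W * N') * N = W := by
  obtain ⟨B, rfl⟩ := exists_conjTranspose_mul_self hW
  have hN : N * (1 - N * N') = 0 := by
    rw [mul_sub, mul_one, ← hτ.comm, ← mul_assoc, hτ.mul_mul, sub_self]
  have hB : B * (1 - N * N') = 0 := by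
    rw [← Matrix.trace_conjTranspose_mul_self_eq_zero_iff]
    have h1 := (Matrix.posSemidef_conjTranspose_mul_self (B * (1 - N * N'))).trace_nonneg
    have h2 := (hle.conjTranspose_mul_mul_same (1 - N * N')).trace_nonneg
    have h3 : (1 - N * N').conjTranspose * ((μ : ℂ) • τ - B.conjTranspose * B) * (1 - N * N')
        = - ((B * (1 - N * N')).conjTranspose * (B * (1 - N * N'))) := by
      rw [← hτ.mul_self, Matrix.conjTranspose_mul, Matrix.mul_assoc, sub_mul, smul_mul_assoc,
        Matrix.mul_assoc N N, hN]
      simp only [Matrix.mul_assoc, mul_zero, smul_zero, zero_sub, mul_neg]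
    rw [h3, Matrix.trace_neg] at h2
    exact le_antisymm (by simpa using h2) h1
  have hB' : B * (N * N') = B := by
    rw [mul_sub, mul_one, sub_eq_zero] at hB
    exact hB.symm
  have hB'' : N * N' * B.conjTranspose = B.conjTranspose := by
    have := congrArg Matrix.conjTranspose hB'
    rwa [Matrix.conjTranspose_mul, hτ.conjTranspose_proj] at this
  calc N * (N' * (B.conjTranspose * B) * N') * N
      = (N * N' * B.conjTranspose) * (B * (N' * N)) := by simp only [Matrix.mul_assoc]
    _ = _ := by rw [hτ.comm, hB', hB'']

lemma IsSqrtPinv.posSemidef_density : (N' * W * N').PosSemidef := by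
  simpa [hτ.isHermitian'.eq] using hW.conjTranspose_mul_mul_same N'

/-- The relative density `G` satisfies `0 ≤ G ≤ μ`, hence `G² ≤ μ G`. -/
lemma IsSqrtPinv.re_trace_density_sq_le (hμ : 0 < μ) (hle : ((μ : ℂ) • τ - W).PosSemidef) :
    (N * ((N' * W * N') * (N' * W * N')) * N).trace.re ≤ μ * W.trace.re := by
  have hG := hτ.posSemidef_density hW
  have hNGN := hτ.mul_density_mul hW hle
  have hμc : (0 : ℂ) ≤ μ := by exact_mod_cast hμ.le
  have h1 : ((μ : ℂ) • 1 - N' * W * N').PosSemidef := by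
    have h := (hle.conjTranspose_mul_mul_same N').add
      ((Matrix.posSemidef_conjTranspose_mul_self (1 - N * N')).smul hμc)
    convert h using 1
    have e : (1 - N * N').conjTranspose * (1 - N * N') = 1 - N * N' := by
      rw [Matrix.conjTranspose_sub, hτ.conjTranspose_proj, Matrix.conjTranspose_one, mul_sub,
        mul_one, sub_mul, one_mul, ← mul_assoc, hτ.mul_mul, sub_self, sub_zero]
    have e' : N' * τ * N' = N * N' := by
      rw [← hτ.mul_self, ← mul_assoc, hτ.comm, hτ.mul_mul]
    rw [e, hτ.isHermitian'.eq, mul_sub, sub_mul, mul_smul_comm, smul_mul_assoc, e']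
    module
  set G := N' * W * N'
  have h2 := hG.conjTranspose_mul_mul_same ((μ : ℂ) • 1 - G)
  have h3 := h1.conjTranspose_mul_mul_same G
  rw [h1.isHermitian.eq] at h2
  rw [hG.isHermitian.eq] at h3
  have h4 := re_trace_nonneg ((h2.add h3).conjTranspose_mul_mul_same N)
  have e : ((μ : ℂ) • 1 - G) * G * ((μ : ℂ) • 1 - G) + G * ((μ : ℂ) • 1 - G) * G
      = (μ : ℂ) • ((μ : ℂ) • G - G * G) := by
    simp only [mul_sub, sub_mul, smul_mul_assoc, mul_smul_comm, one_mul, mul_one, smul_sub,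
      Matrix.mul_assoc]
    module
  rw [e, hτ.isHermitian.eq, mul_smul_comm, smul_mul_assoc, mul_sub, sub_mul, mul_smul_comm,
    smul_mul_assoc, hNGN, Matrix.trace_smul, Matrix.trace_sub, Matrix.trace_smul] at h4
  simp only [smul_eq_mul, Complex.re_ofReal_mul, Complex.sub_re] at h4
  have := nonneg_of_mul_nonneg_right h4 hμ
  linarith

end

variable {I r b κ : Type} [Fintype I] [DecidableEq I] [Fintype r] [DecidableEq r]
  [Fintype b] [DecidableEq b] [Fintype κ] [Nonempty κ]

/-- The convex split lemma in trace norm. With `W = N G N` for the square root `N` of `ρ ⊗ W_b`,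
the densities `G` placed at distinct positions are uncorrelated, because the `b`-marginal of
`(ρ ⊗ W_b) G` is `W_b`; so the variance bound applies. -/
lemma convexSplit {ρ : Matrix r r ℂ} (hρ : IsState ρ) {W : Matrix (r × b) (r × b) ℂ}
    (hW : W.PosSemidef) {μ : ℝ} (hμ : 0 < μ)
    (hle : ((μ : ℂ) • (ρ ⊗ₖ traceLeft W) - W).PosSemidef) {pos : κ → I}
    (hpos : Function.Injective pos) {T : Matrix ((I → r) × b) ((I → r) × b) ℂ}
    (hT : IsContraction T) :
    (T * ((Fintype.card κ : ℝ)⁻¹ • ∑ k, place ρ (pos k) W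
      - piKron I ρ ⊗ₖ traceLeft W)).trace.re ≤
      √W.trace.re * √((μ - 1) * W.trace.re / Fintype.card κ) := by
  classical
  obtain ⟨P, P', hP⟩ := exists_isSqrtPinv hρ.1
  obtain ⟨Q, Q', hQ⟩ := exists_isSqrtPinv (posSemidef_traceLeft hW)
  have hN := hP.kronecker hQ
  have hG := hN.posSemidef_density hW
  have hNGN := hN.mul_density_mul hW hle
  have hsq := hN.re_trace_density_sq_le hW hμ hle
  -- the support of `G` on `b` lies in the support of `W_b`
  have hGQ : (P' ⊗ₖ Q' * W * P' ⊗ₖ Q') * ((1 : Matrix r r ℂ) ⊗ₖ (Q * Q'))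
      = P' ⊗ₖ Q' * W * P' ⊗ₖ Q' := by
    rw [Matrix.mul_assoc _ (P' ⊗ₖ Q'), ← Matrix.mul_kronecker_mul, Matrix.mul_one,
      ← Matrix.mul_assoc Q', hQ.mul_mul']
  generalize P' ⊗ₖ Q' * W * P' ⊗ₖ Q' = G at hG hNGN hsq hGQ
  have hmarg : traceLeft ((ρ ⊗ₖ traceLeft W) * G) = traceLeft W := by
    have e1 : (ρ ⊗ₖ traceLeft W) * G
        = (P ⊗ₖ 1) * ((1 ⊗ₖ Q) * ((P ⊗ₖ Q) * G * ((1 : Matrix r r ℂ) ⊗ₖ (Q * Q')))) := by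
      rw [Matrix.mul_assoc (P ⊗ₖ Q), hGQ, ← Matrix.mul_assoc (1 ⊗ₖ Q), ← Matrix.mul_kronecker_mul,
        ← Matrix.mul_assoc, ← Matrix.mul_kronecker_mul, Matrix.one_mul, Matrix.one_mul,
        hP.mul_self, hQ.mul_self]
    have e2 : (1 ⊗ₖ Q) * ((P ⊗ₖ Q) * G * ((1 : Matrix r r ℂ) ⊗ₖ (Q * Q'))) * (P ⊗ₖ 1)
        = (1 ⊗ₖ Q) * ((P ⊗ₖ Q * G * P ⊗ₖ Q) * ((1 : Matrix r r ℂ) ⊗ₖ Q')) := by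
      simp only [Matrix.mul_assoc, ← Matrix.mul_kronecker_mul, Matrix.mul_one, Matrix.one_mul]
    rw [e1, traceLeft_kronecker_one_mul_comm, e2, hNGN, traceLeft_one_kronecker_mul,
      traceLeft_mul_one_kronecker]
    conv_rhs => rw [← hQ.mul_self]
    conv_lhs => rw [← hQ.mul_self]
    rw [Matrix.mul_assoc Q Q, ← hQ.comm, ← Matrix.mul_assoc Q Q', hQ.mul_mul]
  set Nn := piKron I P ⊗ₖ Q with hNn
  have hplace (k : I) : Nn = place P k (P ⊗ₖ Q) := (place_kronecker P k Q).symm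
  have hconj (k : I) (X : Matrix (r × b) (r × b) ℂ) :
      Nn * place 1 k X * Nn = place ρ k (P ⊗ₖ Q * X * P ⊗ₖ Q) := by
    rw [hplace k, place_mul, place_mul, Matrix.mul_one, hP.mul_self]
  have hNnh : Nn.IsHermitian := by
    rw [Matrix.IsHermitian, hNn, Matrix.conjTranspose_kronecker, ← piKron_conjTranspose,
      hP.isHermitian.eq, hQ.isHermitian.eq]
  have hNnNn : Nn * Nn = piKron I ρ ⊗ₖ traceLeft W := by
    rw [hNn, ← Matrix.mul_kronecker_mul, ← piKron_mul, hP.mul_self, hQ.mul_self]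
  have h := re_trace_mul_average_sub_le (κ := κ) hT hNnh
    (G := fun k => place 1 (pos k) G) (t := W.trace.re) (μ := μ)
    (fun k => (posSemidef_place .one _ hG).isHermitian) ?_ ?_ ?_ ?_
  · simpa only [hconj, hNGN, hNnNn] using h
  · rw [hNnNn, Matrix.trace_kronecker, (isState_piKron hρ).2, one_mul, trace_traceLeft]
  · intro k
    rw [hconj, hNGN, trace_place hρ]
  · intro k l hkl
    have e : Nn * (place 1 (pos k) G * place 1 (pos l) G) * Nn
        = (Nn * place 1 (pos k) G) * (place 1 (pos l) G * Nn) := by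
      simp only [Matrix.mul_assoc]
    rw [e, Matrix.trace_mul_comm, Matrix.mul_assoc, ← Matrix.mul_assoc Nn, hNnNn,
      ← place_kronecker ρ (pos k), place_mul, Matrix.mul_one, Matrix.trace_mul_comm,
      trace_place_mul_place_of_ne hρ (fun h => hkl (hpos h)), hmarg, ← hN.mul_self,
      Matrix.mul_assoc, Matrix.trace_mul_comm, hNGN]
  · intro k
    rw [place_mul, Matrix.mul_one, hconj, trace_place hρ]
    exact hsq

end ConvexSplit

/-! ### Position-based decoding and secrecy -/

section Decoding

variable {n : Type} [Fintype n] [DecidableEq n]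

lemma isUnit_of_isUnit_mul_self {R : Matrix n n ℂ} (h : IsUnit (R * R)) : IsUnit R := by
  rw [Matrix.isUnit_iff_isUnit_det, Matrix.det_mul] at h
  exact (Matrix.isUnit_iff_isUnit_det R).mpr (isUnit_of_mul_isUnit_left h)

/-- The square-root measurement for a family of tests, coarse-grained over `k`. The regularization
`t` makes the sum of the tests invertible, at the price of an additional error of order `t`. -/
lemma exists_measurement {M K : ℕ} [NeZero M] {Λ : Fin M × Fin K → Matrix n n ℂ}
    (hΛ : ∀ i, IsTest (Λ i)) {ω : Fin M × Fin K → Matrix n n ℂ} (hω : ∀ i, IsState (ω i))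
    {c t e x : ℝ} (hc : 0 < c) (ht : 0 < t) (he : ∀ i, 1 - e ≤ (Λ i * ω i).trace.re)
    (hx : ∀ i j, i ≠ j → (Λ j * ω i).trace.re ≤ x) :
    ∃ D : Fin M → Matrix n n ℂ, (∀ m, (D m).PosSemidef) ∧ ∑ m, D m = 1 ∧
      ∀ m k, ((1 - D m) * ω (m, k)).trace.re ≤
        (1 + c) * e + (2 + c + c⁻¹) * (((M * K : ℕ) - 1) * x + t) := by
  set S := ∑ i, Λ i + (t : ℂ) • (1 : Matrix n n ℂ) with hS
  have htc : (0 : ℂ) < t := by exact_mod_cast ht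
  have hSpd : S.PosDef :=
    (Matrix.PosDef.one.smul htc).posSemidef_add (Matrix.posSemidef_sum _ fun i _ => (hΛ i).1)
  have hRR := psdSqrt_mul_self hSpd.posSemidef
  have hRu : IsUnit (psdSqrt S) := isUnit_of_isUnit_mul_self (by rw [hRR]; exact hSpd.isUnit)
  obtain ⟨X, hX⟩ : ∃ X, X = (psdSqrt S)⁻¹ := ⟨_, rfl⟩
  have hXR : X * psdSqrt S = 1 := by
    rw [hX]; exact Matrix.nonsing_inv_mul _ ((Matrix.isUnit_iff_isUnit_det _).mp hRu)
  have hXh : X.IsHermitian := hX ▸ (posSemidef_psdSqrt S).isHermitian.inv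
  have hXSX : X * S * X = 1 := by
    rw [← hRR, ← Matrix.mul_assoc, hXR, Matrix.one_mul, mul_eq_one_comm.mp hXR]
  have hconj {Y : Matrix n n ℂ} (hY : Y.PosSemidef) : (X * Y * X).PosSemidef := by
    simpa [hXh.eq] using hY.conjTranspose_mul_mul_same X
  have hE (i) : (X * Λ i * X).PosSemidef := hconj (hΛ i).1
  have hrest : (X * ((t : ℂ) • 1) * X).PosSemidef := hconj (Matrix.PosSemidef.one.smul htc.le)
  let rest (m : Fin M) : Matrix n n ℂ := if m = 0 then X * ((t : ℂ) • 1) * X else 0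
  have hrest' (m) : (rest m).PosSemidef := by
    simp only [rest]; split_ifs
    · exact hrest
    · exact .zero
  let D (m : Fin M) : Matrix n n ℂ := ∑ k, X * Λ (m, k) * X + rest m
  have hD (m) : (D m).PosSemidef :=
    (Matrix.posSemidef_sum _ fun k _ => hE _).add (hrest' m)
  refine ⟨D, hD, ?_, fun m k => ?_⟩
  · simp only [D, Finset.sum_add_distrib, rest, Finset.sum_ite_eq', Finset.mem_univ, if_true]
    rw [← Fintype.sum_prod_type', ← Finset.sum_mul, ← Finset.mul_sum, ← add_mul, ← mul_add, ← hS,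
      hXSX]
  · set i := (m, k) with hi
    obtain ⟨Q, hQ⟩ : ∃ Q, Q = ∑ j ∈ Finset.univ.erase i, Λ j + (t : ℂ) • (1 : Matrix n n ℂ) :=
      ⟨_, rfl⟩
    have hQS : Λ i + Q = S := by
      rw [hQ, hS, ← add_assoc, Finset.add_sum_erase _ _ (Finset.mem_univ i)]
    have hQpos : Q.PosSemidef := by
      rw [hQ]
      exact (Matrix.posSemidef_sum _ fun j _ => (hΛ j).1).add
        (Matrix.PosSemidef.one.smul htc.le)
    have hHN := hayashiNagaoka (hΛ i) hQpos hXh (by rw [hQS]; exact hXR) hc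
    have hDE : (1 - X * Λ i * X - (1 - D m)).PosSemidef := by
      have : 1 - X * Λ i * X - (1 - D m)
          = ∑ l ∈ Finset.univ.erase k, X * Λ (m, l) * X + rest m := by
        simp only [D]
        rw [← Finset.add_sum_erase _ _ (Finset.mem_univ k)]
        abel
      rw [this]
      exact (Matrix.posSemidef_sum _ fun l _ => hE _).add (hrest' m)
    refine (re_trace_mul_le hDE (hω i).1).trans ((re_trace_mul_le hHN (hω i).1).trans ?_)
    have hQx : (Q * ω i).trace.re ≤ ((M * K : ℕ) - 1) * x + t := by
      rw [hQ, Matrix.add_mul, Matrix.trace_add, Finset.sum_mul, Matrix.trace_sum,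
        Matrix.smul_mul, Matrix.one_mul, Matrix.trace_smul, (hω i).2, Complex.add_re,
        Complex.re_sum]
      have h1 : ∑ j ∈ Finset.univ.erase i, (Λ j * ω i).trace.re ≤ ((M * K : ℕ) - 1) * x := by
        refine (Finset.sum_le_sum fun j hj => hx i j (Finset.ne_of_mem_erase hj).symm).trans_eq ?_
        rw [Finset.sum_const, Finset.card_erase_of_mem (Finset.mem_univ i), Finset.card_univ,
          Fintype.card_prod, Fintype.card_fin, Fintype.card_fin, nsmul_eq_mul, Nat.cast_sub,
          Nat.cast_one]
        exact Nat.mul_pos (NeZero.pos M) k.pos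
      simpa using h1
    rw [Matrix.add_mul, Matrix.trace_add, Matrix.smul_mul, Matrix.smul_mul, Matrix.trace_smul,
      Matrix.trace_smul, Matrix.sub_mul, Matrix.one_mul, Matrix.trace_sub, (hω i).2,
      Complex.add_re, Complex.smul_re, Complex.smul_re, Complex.sub_re, Complex.one_re]
    have := he i
    have hc' : 0 < c⁻¹ := inv_pos.mpr hc
    exact add_le_add (mul_le_mul_of_nonneg_left (by linarith) (by linarith))
      (mul_le_mul_of_nonneg_left hQx (by linarith))

variable {I r b : Type} [Fintype I] [DecidableEq I] [Fintype r] [DecidableEq r]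
  [Fintype b] [DecidableEq b]

lemma isState_place {ρ : Matrix r r ℂ} (hρ : IsState ρ) (k : I) {W : Matrix (r × b) (r × b) ℂ}
    (hW : IsState W) : IsState (place ρ k W) :=
  ⟨posSemidef_place hρ.1 k hW.1, by rw [trace_place hρ, hW.2]⟩

/-- Position-based decoding. A test `Λ` that accepts `ω` with probability at least `1 - e` and the
product of its marginals with probability at most `x` locates the copy of `r` that is
correlated with `b`. -/
lemma exists_positionDecoder {M K : ℕ} [NeZero M] {ω Λ : Matrix (r × b) (r × b) ℂ}
    (hω : IsState ω) (hΛ : IsTest Λ) (hρ : IsState (traceRight ω)) {c t e x : ℝ} (hc : 0 < c)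
    (ht : 0 < t) (he : 1 - e ≤ (Λ * ω).trace.re)
    (hx : (Λ * (traceRight ω ⊗ₖ traceLeft ω)).trace.re ≤ x) :
    ∃ D : Fin M → Matrix ((Fin M × Fin K → r) × b) ((Fin M × Fin K → r) × b) ℂ,
      (∀ m, (D m).PosSemidef) ∧ ∑ m, D m = 1 ∧
      ∀ m k, ((1 - D m) * place (traceRight ω) (m, k) ω).trace.re ≤
        (1 + c) * e + (2 + c + c⁻¹) * (((M * K : ℕ) - 1) * x + t) := by
  refine exists_measurement (fun i => isTest_place hΛ i) (fun i => isState_place hρ i hω) hc ht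
    (fun i => ?_) fun i j hij => ?_
  · rwa [Matrix.trace_mul_comm, trace_place_mul_place_self hρ, Matrix.trace_mul_comm]
  · rwa [Matrix.trace_mul_comm, trace_place_mul_place_of_ne hρ hij, Matrix.trace_mul_comm]

end Decoding

section Security

variable {I r b κ : Type} [Fintype I] [DecidableEq I] [Fintype r] [DecidableEq r]
  [Fintype b] [DecidableEq b] [Fintype κ] [Nonempty κ]

lemma IsContraction.submatrix {m n : Type} [Fintype m] [Fintype n] [DecidableEq m] [DecidableEq n]
    {T : Matrix n n ℂ} (hT : IsContraction T) (e : m ≃ n) : IsContraction (T.submatrix e e) := by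
  constructor
  · simpa [Matrix.submatrix_sub] using hT.one_sub.submatrix e
  · simpa [Matrix.submatrix_add] using hT.one_add.submatrix e

lemma isContraction_one {n : Type} [Fintype n] [DecidableEq n] :
    IsContraction (1 : Matrix n n ℂ) :=
  ⟨by simpa using Matrix.PosSemidef.zero, Matrix.PosSemidef.one.add Matrix.PosSemidef.one⟩

lemma IsContraction.exists_trace_mul_place {T : Matrix ((I → r) × b) ((I → r) × b) ℂ}
    (hT : IsContraction T) {ρ : Matrix r r ℂ} (hρ : IsState ρ) (k : I) :
    ∃ T' : Matrix (r × b) (r × b) ℂ, IsContraction T' ∧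
      ∀ W, (T * place ρ k W).trace = (T' * W).trace := by
  obtain ⟨T', hT', h⟩ := (hT.submatrix (placeEquiv k).symm).exists_trace_mul_kronecker
    (isState_piKron (I := {j // j ≠ k}) hρ)
  refine ⟨T', hT', fun W => ?_⟩
  rw [← h, place, ← trace_submatrix_equiv (placeEquiv k).symm,
    ← Matrix.submatrix_mul_equiv _ _ _ (placeEquiv k).symm, Matrix.submatrix_submatrix]
  simp

lemma re_trace_pos_of_mem_stateBall {ω ω' : Matrix r r ℂ} (hω : IsState ω) {ε : ℝ} (hε : ε < 1)
    (hω' : ω' ∈ stateBall ε ω) : 0 < ω'.trace.re := by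
  have h := isContraction_one.re_trace_mul_sub_add_le hω hω'.1
  rw [Matrix.one_mul, Matrix.trace_sub, hω.2, Complex.sub_re, Complex.one_re] at h
  linarith [hω'.2]

lemma one_le_of_posSemidef_sub {ρ : Matrix r r ℂ} (hρ : IsState ρ) {W : Matrix (r × b) (r × b) ℂ}
    (hW : 0 < W.trace.re) {μ : ℝ} (hle : ((μ : ℂ) • (ρ ⊗ₖ traceLeft W) - W).PosSemidef) :
    1 ≤ μ := by
  have := re_trace_nonneg hle
  rw [Matrix.trace_sub, Matrix.trace_smul, Matrix.trace_kronecker, hρ.2, one_mul, trace_traceLeft,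
    Complex.sub_re, smul_eq_mul, Complex.re_ofReal_mul] at this
  by_contra! h
  nlinarith

/-- Hiding the position of the correlated copy among `|κ|` candidates makes the state close to a
fixed one. The trace missing from the smoothed state `ω'`, which is lost when the reference state
is normalized, is regained from the generalized trace distance between `ω` and `ω'`. -/
lemma exists_reference_state {ρ : Matrix r r ℂ} (hρ : IsState ρ) {ω ω' : Matrix (r × b) (r × b) ℂ}
    (hω : IsState ω) {δ η : ℝ} (hδ : δ < 1) (hη : 0 < η) (hω' : ω' ∈ stateBall (δ - η) ω) {μ : ℝ}
    (hle : ((μ : ℂ) • (ρ ⊗ₖ traceLeft ω') - ω').PosSemidef)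
    (hκ : μ - 1 ≤ 4 * η ^ 2 * Fintype.card κ) :
    ∃ σ : Matrix ((I → r) × b) ((I → r) × b) ℂ, IsState σ ∧
      ∀ pos : κ → I, Function.Injective pos → (1 / 2 : ℝ) *
        traceNorm ((Fintype.card κ : ℝ)⁻¹ • ∑ k, place ρ (pos k) ω - σ) ≤ δ := by
  have ht := re_trace_pos_of_mem_stateBall hω (by linarith) hω'
  have hμ := one_le_of_posSemidef_sub hρ ht hle
  obtain ⟨⟨hpsd, ht1⟩, hdist⟩ := hω'
  have htr := trace_eq_re hpsd
  set t := ω'.trace.re with htdef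
  have hK : (0 : ℝ) < Fintype.card κ := by exact_mod_cast Fintype.card_pos
  obtain ⟨τ, hτ⟩ : ∃ τ, τ = piKron I ρ ⊗ₖ traceLeft ω' := ⟨_, rfl⟩
  have hτpos : τ.PosSemidef := hτ ▸ (posSemidef_piKron hρ.1).kronecker (posSemidef_traceLeft hpsd)
  have hτtr : τ.trace = t := by
    rw [hτ, Matrix.trace_kronecker, (isState_piKron hρ).2, one_mul, trace_traceLeft, htr]
  have hσ : IsState (t⁻¹ • τ) := by
    refine ⟨hτpos.smul (inv_pos.mpr ht).le, ?_⟩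
    rw [Matrix.trace_smul, hτtr, Complex.real_smul, ← Complex.ofReal_mul, inv_mul_cancel₀ ht.ne',
      Complex.ofReal_one]
  refine ⟨t⁻¹ • τ, hσ, fun pos hpos => ?_⟩
  have hH : ((Fintype.card κ : ℝ)⁻¹ • ∑ k, place ρ (pos k) ω - t⁻¹ • τ).IsHermitian :=
    ((Matrix.posSemidef_sum _ fun k _ => posSemidef_place hρ.1 (pos k) hω.1).smul
      (inv_pos.mpr hK).le).isHermitian.sub hσ.1.isHermitian
  obtain ⟨T, hT, hTn⟩ := exists_isContraction_traceNorm hH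
  rw [← hTn]
  have hsplit : (Fintype.card κ : ℝ)⁻¹ • ∑ k, place ρ (pos k) ω - t⁻¹ • τ
      = (Fintype.card κ : ℝ)⁻¹ • ∑ k, place ρ (pos k) (ω - ω')
        + ((Fintype.card κ : ℝ)⁻¹ • ∑ k, place ρ (pos k) ω' - τ) - (t⁻¹ - 1) • τ := by
    simp only [place_sub, Finset.sum_sub_distrib, smul_sub, sub_smul, one_smul]
    abel
  have h1 : (T * ((Fintype.card κ : ℝ)⁻¹ • ∑ k, place ρ (pos k) (ω - ω'))).trace.re
      ≤ 2 * (δ - η) - (1 - t) := by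
    rw [mul_smul_comm, Matrix.trace_smul, Complex.smul_re, Finset.mul_sum, Matrix.trace_sum,
      Complex.re_sum, smul_eq_mul, inv_mul_le_iff₀ hK]
    refine (Finset.sum_le_card_nsmul _ _ (2 * (δ - η) - (1 - t)) fun k _ => ?_).trans_eq
      (by rw [nsmul_eq_mul, Finset.card_univ])
    obtain ⟨T', hT', h⟩ := hT.exists_trace_mul_place hρ (pos k)
    rw [h]
    linarith [hT'.re_trace_mul_sub_add_le hω ⟨hpsd, ht1⟩]
  have h2 := convexSplit hρ hpsd (by linarith) hle hpos hT
  rw [← hτ, ← htdef] at h2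
  have h3 : √t * √((μ - 1) * t / Fintype.card κ) ≤ 2 * η := by
    rw [← Real.sqrt_mul ht.le]
    refine Real.sqrt_le_iff.mpr ⟨by linarith, ?_⟩
    rw [mul_div_assoc', div_le_iff₀ hK]
    have : t * t ≤ 1 := by nlinarith
    nlinarith [mul_nonneg (sub_nonneg.mpr hμ) (sub_nonneg.mpr this)]
  have h4 : -((t⁻¹ - 1) * (T * τ).trace.re) ≤ 1 - t := by
    have h5 := hT.neg.re_trace_mul_le hτpos
    rw [Matrix.neg_mul, Matrix.trace_neg, hτtr, Complex.neg_re, Complex.ofReal_re] at h5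
    have h6 : 0 ≤ t⁻¹ - 1 := sub_nonneg.mpr ((one_le_inv₀ ht).mpr ht1)
    calc _ = (t⁻¹ - 1) * (-(T * τ).trace.re) := by ring
      _ ≤ (t⁻¹ - 1) * t := by gcongr
      _ = 1 - t := by field_simp
  have h5 : (T * ((t⁻¹ - 1) • τ)).trace.re = (t⁻¹ - 1) * (T * τ).trace.re := by
    rw [mul_smul_comm, Matrix.trace_smul, Complex.smul_re, smul_eq_mul]
  rw [hsplit, mul_sub, mul_add, Matrix.trace_sub, Matrix.trace_add, Complex.sub_re, Complex.add_re,
    h5]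
  linarith

end Security

/-! ### The code -/

section Encoding

variable {I A r : Type} [Fintype I] [DecidableEq I] [Fintype A] [Fintype r] [DecidableEq r]

/-- The tensor power `ρ^{⊗ I}` of a bipartite operator, as an operator on the bipartite system whose
parts are `I` copies of `r` and `I` copies of `A`. -/
def bipartitePower (I : Type) [Fintype I] (ρ : Matrix (r × A) (r × A) ℂ) :
    Matrix ((I → r) × (I → A)) ((I → r) × (I → A)) ℂ :=
  (piKron I ρ).submatrix (fun p j => (p.1 j, p.2 j)) (fun p j => (p.1 j, p.2 j))

lemma isState_bipartitePower {ρ : Matrix (r × A) (r × A) ℂ} (hρ : IsState ρ) :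
    IsState (bipartitePower I ρ) := by
  classical
  refine ⟨(posSemidef_piKron hρ.1).submatrix _, ?_⟩
  rw [← (isState_piKron (I := I) hρ).2]
  exact trace_submatrix_equiv (Equiv.arrowProdEquivProdArrow I (fun _ => r) fun _ => A).symm _

lemma tensorId_apply {a b R : Type} (Φ : Matrix a a ℂ →ₗ[ℂ] Matrix b b ℂ)
    (X : Matrix (R × a) (R × a) ℂ) (p q : R × b) :
    tensorId R Φ X p q = Φ (Matrix.of fun x y => X (p.1, x) (q.1, y)) p.2 q.2 := rfl

/-- The action of `randomSelect` on operators. -/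
def randomSelectMap {κ : Type} [Fintype κ] (A : Type) [Fintype A] (pos : κ → I) :
    Matrix (I → A) (I → A) ℂ →ₗ[ℂ] Matrix A A ℂ where
  toFun X := Matrix.of fun a a' => (Fintype.card κ : ℂ)⁻¹ * ∑ k, ∑ z,
    X ((Equiv.funSplitAt (pos k) A).symm (a, z)) ((Equiv.funSplitAt (pos k) A).symm (a', z))
  map_add' X Y := by
    ext a a'
    simp [Finset.sum_add_distrib, mul_add]
  map_smul' c X := by
    ext a a'
    simp only [Matrix.smul_apply, Matrix.of_apply, smul_eq_mul, RingHom.id_apply,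
      ← Finset.mul_sum]
    ring

lemma randomSelectMap_apply {κ : Type} [Fintype κ] (pos : κ → I) (X : Matrix (I → A) (I → A) ℂ)
    (a a' : A) : randomSelectMap A pos X a a' = (Fintype.card κ : ℂ)⁻¹ * ∑ k, ∑ z,
    X ((Equiv.funSplitAt (pos k) A).symm (a, z)) ((Equiv.funSplitAt (pos k) A).symm (a', z)) := rfl

/-- The channel that keeps one of the `I` copies of `A`, at a position drawn uniformly from the
family `pos`, and discards the others. -/
def randomSelect {κ : Type} [Fintype κ] [Nonempty κ] (A : Type) [Fintype A] (pos : κ → I) :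
    Channel (I → A) A where
  map := randomSelectMap A pos
  completelyPositive n X hX := by
    have h : tensorId (Fin n) (randomSelectMap A pos) X = (Fintype.card κ : ℂ)⁻¹ • ∑ k : κ, ∑ z,
        X.submatrix (fun p => (p.1, (Equiv.funSplitAt (pos k) A).symm (p.2, z)))
          (fun p => (p.1, (Equiv.funSplitAt (pos k) A).symm (p.2, z))) := by
      ext p q
      simp only [Matrix.smul_apply, Matrix.sum_apply, Matrix.submatrix_apply, smul_eq_mul,
        tensorId_apply, randomSelectMap_apply, Matrix.of_apply]
    rw [h]
    refine (Matrix.posSemidef_sum _ fun k _ => Matrix.posSemidef_sum _ fun z _ =>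
      hX.submatrix _).smul ?_
    exact inv_nonneg.mpr (Nat.cast_nonneg _)
  tracePreserving X := by
    have h (k : κ) : ∑ a, ∑ z, X ((Equiv.funSplitAt (pos k) A).symm (a, z))
        ((Equiv.funSplitAt (pos k) A).symm (a, z)) = X.trace := by
      rw [← Fintype.sum_prod_type']
      exact Fintype.sum_equiv (Equiv.funSplitAt (pos k) A).symm _ _ fun _ => rfl
    rw [Matrix.trace]
    simp only [Matrix.diag_apply, randomSelectMap_apply, ← Finset.mul_sum]
    rw [Finset.sum_comm, Finset.sum_congr rfl fun k _ => h k, Finset.sum_const, Finset.card_univ,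
      nsmul_eq_mul, inv_mul_cancel_left₀ (by simp [Fintype.card_ne_zero])]

lemma tensorId_randomSelect {κ : Type} [Fintype κ] [Nonempty κ] (pos : κ → I)
    (ρ : Matrix (r × A) (r × A) ℂ) (p q : (I → r) × A) :
    tensorId (I → r) (randomSelect A pos).map (bipartitePower I ρ) p q =
      (Fintype.card κ : ℂ)⁻¹ * ∑ k, (∏ j : {j // j ≠ pos k}, traceRight ρ (p.1 j.1) (q.1 j.1)) *
        ρ (p.1 (pos k), p.2) (q.1 (pos k), q.2) := by
  classical
  rw [tensorId_apply, randomSelect, randomSelectMap_apply]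
  congr 1
  refine Finset.sum_congr rfl fun k _ => ?_
  simp only [traceRight, Fintype.prod_sum, Finset.sum_mul]
  refine Finset.sum_congr rfl fun z _ => ?_
  rw [Matrix.of_apply, bipartitePower, Matrix.submatrix_apply, piKron_apply,
    Fintype.prod_eq_mul_prod_subtype_ne _ (pos k), mul_comm]
  congr 1
  · refine Finset.prod_congr rfl fun j _ => ?_
    simp [j.2]
  · simp

end Encoding

section Marginal

variable {A ι : Type} [Fintype A] [Fintype ι] [DecidableEq ι]
  {d : ι → Type} [∀ i, Fintype (d i)] [∀ i, DecidableEq (d i)]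

lemma posSemidef_marginal {R : Type} (S : Finset ι)
    {Ω : Matrix (R × (∀ i, d i)) (R × (∀ i, d i)) ℂ} (hΩ : Ω.PosSemidef) :
    (marginal S Ω).PosSemidef := by
  have h : marginal S Ω = ∑ z : (∀ i : {i // ¬ i ∈ S}, d i), Ω.submatrix
      (fun u => (u.1, (Equiv.piEquivPiSubtypeProd (fun i => i ∈ S) d).symm (u.2, z)))
      (fun u => (u.1, (Equiv.piEquivPiSubtypeProd (fun i => i ∈ S) d).symm (u.2, z))) := by
    ext u v
    simp only [marginal, Matrix.sum_apply, Matrix.submatrix_apply]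
  rw [h]
  exact Matrix.posSemidef_sum _ fun z _ => hΩ.submatrix _

lemma traceRight_marginal {R : Type} (S : Finset ι)
    (Ω : Matrix (R × (∀ i, d i)) (R × (∀ i, d i)) ℂ) :
    traceRight (marginal S Ω) = traceRight Ω := by
  ext i j
  simp only [traceRight, marginal]
  rw [← Fintype.sum_prod_type']
  exact Fintype.sum_equiv (Equiv.piEquivPiSubtypeProd (fun i => i ∈ S) d).symm _ _ fun _ => rfl

lemma traceRight_tensorId {B R : Type} [Fintype B] (N : Channel A B)
    (X : Matrix (R × A) (R × A) ℂ) : traceRight (tensorId R N.map X) = traceRight X := by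
  ext i j
  exact N.tracePreserving fun x y => X (i, x) (j, y)

lemma traceRight_marginal_tensorId {R : Type} (N : Channel A (∀ i, d i)) (S : Finset ι)
    (X : Matrix (R × A) (R × A) ℂ) :
    traceRight (marginal S (tensorId R N.map X)) = traceRight X := by
  rw [traceRight_marginal, traceRight_tensorId]

lemma isState_traceRight {a b : Type} [Fintype a] [Fintype b] [DecidableEq a]
    {X : Matrix (a × b) (a × b) ℂ} (hX : IsState X) : IsState (traceRight X) := by
  classical
  exact ⟨posSemidef_traceRight hX.1, by rw [trace_traceRight, hX.2]⟩

lemma isState_marginal_tensorId {n : ℕ} (N : Channel A (∀ i, d i)) (S : Finset ι)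
    {X : Matrix (Fin n × A) (Fin n × A) ℂ} (hX : IsState X) :
    IsState (marginal S (tensorId (Fin n) N.map X)) := by
  classical
  refine ⟨posSemidef_marginal S (N.completelyPositive n X hX.1), ?_⟩
  rw [← trace_traceRight, traceRight_marginal_tensorId, trace_traceRight, hX.2]

/-- The output of the channel on a randomly selected copy is the uniform mixture, over the
positions, of the output for a single copy placed at that position. -/
lemma marginal_tensorId_randomSelect {I r κ : Type} [Fintype I] [DecidableEq I] [Fintype r]
    [DecidableEq r] [Fintype κ] [Nonempty κ] (N : Channel A (∀ i, d i)) (S : Finset ι)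
    (pos : κ → I) (ρ : Matrix (r × A) (r × A) ℂ) :
    marginal S (tensorId (I → r) N.map
        (tensorId (I → r) (randomSelect A pos).map (bipartitePower I ρ))) =
      (Fintype.card κ : ℝ)⁻¹ • ∑ k, place (traceRight ρ) (pos k)
        (marginal S (tensorId r N.map ρ)) := by
  have h (p q : (I → r) × (∀ i, d i)) : tensorId (I → r) N.map
      (tensorId (I → r) (randomSelect A pos).map (bipartitePower I ρ)) p q =
      (Fintype.card κ : ℂ)⁻¹ * ∑ k, (∏ j : {j // j ≠ pos k}, traceRight ρ (p.1 j.1) (q.1 j.1)) *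
        tensorId r N.map ρ (p.1 (pos k), p.2) (q.1 (pos k), q.2) := by
    have e : (Matrix.of fun x y => tensorId (I → r) (randomSelect A pos).map
        (bipartitePower I ρ) (p.1, x) (q.1, y) : Matrix A A ℂ) = (Fintype.card κ : ℂ)⁻¹ •
          ∑ k, (∏ j : {j // j ≠ pos k}, traceRight ρ (p.1 j.1) (q.1 j.1)) •
            (Matrix.of fun x y => ρ (p.1 (pos k), x) (q.1 (pos k), y) : Matrix A A ℂ) := by
      ext x y
      rw [Matrix.of_apply, tensorId_randomSelect, Matrix.smul_apply, Matrix.sum_apply]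
      rfl
    rw [tensorId_apply, e, map_smul, map_sum, Matrix.smul_apply, Matrix.sum_apply, smul_eq_mul]
    congr 1
    refine Finset.sum_congr rfl fun k _ => ?_
    rw [map_smul]
    rfl
  ext u v
  simp only [marginal, h, Matrix.smul_apply, Matrix.sum_apply, place_apply, Finset.sum_mul]
  rw [← Finset.mul_sum, Finset.sum_comm, Complex.real_smul]
  push_cast
  congr 1
  refine Finset.sum_congr rfl fun k _ => Finset.sum_congr rfl fun z _ => mul_comm _ _

end Marginal

section CodeConstruction

variable {A ι : Type} [Fintype A] [Fintype ι] [DecidableEq ι]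
  {d : ι → Type} [∀ i, Fintype (d i)] [∀ i, DecidableEq (d i)]

/-- The position-based code: `M K` copies of `ρ` are shared, and message `m` is sent through a copy
at a random position of the `m`-th block of length `K`. -/
lemma hasCode_of_decoder (N : Channel A (∀ i, d i)) (𝓑 𝓔 : Finset ι) {M K r : ℕ} [NeZero K]
    {ε δ : ℝ} {ρ : Matrix (Fin r × A) (Fin r × A) ℂ} (hρ : IsState ρ)
    (hdec : ∃ D : Fin M → Matrix ((Fin M × Fin K → Fin r) × (∀ i : {i // i ∈ 𝓑}, d i))
        ((Fin M × Fin K → Fin r) × (∀ i : {i // i ∈ 𝓑}, d i)) ℂ,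
      (∀ m, (D m).PosSemidef) ∧ ∑ m, D m = 1 ∧
      ∀ m k, ((1 - D m) * place (traceRight ρ) (m, k)
        (marginal 𝓑 (tensorId (Fin r) N.map ρ))).trace.re ≤ ε)
    (hsec : ∃ σ : Matrix ((Fin M × Fin K → Fin r) × (∀ i : {i // i ∈ 𝓔}, d i))
        ((Fin M × Fin K → Fin r) × (∀ i : {i // i ∈ 𝓔}, d i)) ℂ, IsState σ ∧
      ∀ m, (1 / 2 : ℝ) * traceNorm ((Fintype.card (Fin K) : ℝ)⁻¹ •
        ∑ k, place (traceRight ρ) (m, k) (marginal 𝓔 (tensorId (Fin r) N.map ρ)) - σ) ≤ δ) :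
    HasCode N 𝓑 𝓔 M ε δ := by
  obtain ⟨D, hD, hD1, hDε⟩ := hdec
  obtain ⟨σ, hσ, hσδ⟩ := hsec
  refine ⟨Fin M × Fin K → Fin r, Fin M × Fin K → A, inferInstance, inferInstance, inferInstance,
    ⟨{ shared := bipartitePower (Fin M × Fin K) ρ
       shared_isState := isState_bipartitePower hρ
       enc := fun m => randomSelect A fun k : Fin K => (m, k)
       dec := D
       dec_posSemidef := hD
       dec_sum := hD1
       reliable := fun m => ?_
       secure := ⟨σ, hσ, fun m => ?_⟩ }⟩⟩
  · rw [marginal_tensorId_randomSelect, mul_smul_comm, Matrix.trace_smul, Complex.smul_re,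
      Finset.mul_sum, Matrix.trace_sum, Complex.re_sum, smul_eq_mul,
      inv_mul_le_iff₀ (by exact_mod_cast Fintype.card_pos)]
    refine (Finset.sum_le_card_nsmul _ _ ε fun k _ => hDε m k).trans_eq ?_
    rw [nsmul_eq_mul, Finset.card_univ]
  · rw [marginal_tensorId_randomSelect]
    exact hσδ m

lemma traceNorm_zero {n : Type} [Fintype n] [DecidableEq n] :
    traceNorm (0 : Matrix n n ℂ) = 0 := by
  obtain ⟨T, -, h⟩ := exists_isContraction_traceNorm (Matrix.isHermitian_zero (n := n) (α := ℂ))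
  simpa using h.symm

/-- A single message can always be transmitted. -/
lemma hasCode_one (N : Channel A (∀ i, d i)) (𝓑 𝓔 : Finset ι) {r : ℕ} {ε δ : ℝ} (hε : 0 ≤ ε)
    (hδ : 0 ≤ δ) {ρ : Matrix (Fin r × A) (Fin r × A) ℂ} (hρ : IsState ρ) :
    HasCode N 𝓑 𝓔 1 ε δ := by
  refine hasCode_of_decoder (K := 1) N 𝓑 𝓔 hρ ⟨fun _ => 1, fun _ => .one, by simp, fun m k => ?_⟩
    ⟨place (traceRight ρ) (0, 0) (marginal 𝓔 (tensorId (Fin r) N.map ρ)),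
      isState_place (isState_traceRight hρ) _ (isState_marginal_tensorId N 𝓔 hρ), fun m => ?_⟩
  · simpa using hε
  · rw [Subsingleton.elim m 0]
    simpa [traceNorm_zero] using hδ

/-- The parameters for which position-based coding combined with convex splitting succeeds: the
number `M K` of positions is bounded by the test for Bob, and the length `K` of a block is large
enough to hide the position from Eve. -/
lemma hasCode_of_test_of_smoothing (N : Channel A (∀ i, d i)) (𝓑 𝓔 : Finset ι) {M K r : ℕ}
    [NeZero M] [NeZero K] {ε δ η₁ η₂ : ℝ} (hη₁ : η₁ ∈ Set.Ioo 0 ε) (hδ : δ < 1) (hη₂ : 0 < η₂)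
    {ρ : Matrix (Fin r × A) (Fin r × A) ℂ} (hρ : IsState ρ)
    {Λ : Matrix (Fin r × (∀ i : {i // i ∈ 𝓑}, d i)) (Fin r × (∀ i : {i // i ∈ 𝓑}, d i)) ℂ}
    (hΛ : IsTest Λ)
    (hΛω : 1 - (ε - η₁) ≤ (Λ * marginal 𝓑 (tensorId (Fin r) N.map ρ)).trace.re) {x : ℝ}
    (hx : (Λ * (traceRight (marginal 𝓑 (tensorId (Fin r) N.map ρ)) ⊗ₖ
      traceLeft (marginal 𝓑 (tensorId (Fin r) N.map ρ)))).trace.re = x)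
    {ω' : Matrix (Fin r × (∀ i : {i // i ∈ 𝓔}, d i)) (Fin r × (∀ i : {i // i ∈ 𝓔}, d i)) ℂ}
    (hω' : ω' ∈ stateBall (δ - η₂) (marginal 𝓔 (tensorId (Fin r) N.map ρ))) {μ : ℝ}
    (hle : ((μ : ℂ) • (traceRight (marginal 𝓔 (tensorId (Fin r) N.map ρ)) ⊗ₖ traceLeft ω')
      - ω').PosSemidef)
    (hK : μ - 1 ≤ 4 * η₂ ^ 2 * K) (hMK : ((M * K : ℕ) - 1) * x < η₁ ^ 2 / (4 * ε)) :
    HasCode N 𝓑 𝓔 M ε δ := by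
  obtain ⟨h1, h2⟩ := hη₁
  have hρR := isState_traceRight hρ
  refine hasCode_of_decoder (K := K) N 𝓑 𝓔 hρ ?_ ?_
  · have hR := traceRight_marginal_tensorId N 𝓑 ρ
    have hcpos : 0 < 2 * ε - η₁ := by linarith
    -- the value of `c` that minimizes the bound
    obtain ⟨c, hc⟩ : ∃ c, c = η₁ / (2 * ε - η₁) := ⟨_, rfl⟩
    obtain ⟨D, hD, hD1, hDe⟩ := exists_positionDecoder (M := M) (K := K)
      (isState_marginal_tensorId N 𝓑 hρ) hΛ (by rw [hR]; exact hρR) (c := c)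
      (hc ▸ div_pos h1 hcpos) (sub_pos.mpr hMK) hΛω hx.le
    refine ⟨D, hD, hD1, fun m k => ?_⟩
    rw [← hR]
    refine (hDe m k).trans_eq ?_
    rw [add_sub_cancel, hc]
    have : ε ≠ 0 := by linarith
    field_simp
    ring
  · have hR := traceRight_marginal_tensorId N 𝓔 ρ
    rw [hR] at hle
    obtain ⟨σ, hσ, h⟩ := exists_reference_state (I := Fin M × Fin K) (κ := Fin K) hρR
      (isState_marginal_tensorId N 𝓔 hρ) hδ hη₂ hω' hle (by simpa using hK)
    exact ⟨σ, hσ, fun m => h (fun k => (m, k)) fun k l hkl => (Prod.ext_iff.mp hkl).2⟩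

end CodeConstruction

/-- The numbers of messages and of positions per message can be rounded to integers without loss:
convex splitting only asks for `K ≥ (μ - 1) / (4 η²)`, while the budget for `M K - 1` is
`ℓ μ / η²`. -/
lemma exists_block_sizes {ℓ μ η : ℝ} (hℓ : 1 < ℓ) (hμ : 1 ≤ μ) (hη : 0 < η) (hη1 : η < 1) :
    ∃ M K : ℕ, 0 < M ∧ 0 < K ∧ ℓ ≤ M ∧ μ - 1 ≤ 4 * η ^ 2 * K ∧
      ((M * K : ℕ) : ℝ) - 1 ≤ ℓ * (μ / η ^ 2) := by
  have hη2 : 0 < η ^ 2 := by positivity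
  obtain ⟨Y, hY⟩ : ∃ Y, Y = μ / η ^ 2 := ⟨_, rfl⟩
  have hμY : μ = η ^ 2 * Y := by rw [hY]; field_simp
  have hY1 : 1 ≤ Y := by
    rw [hY, one_le_div hη2]; nlinarith
  have hM := Nat.ceil_lt_add_one (zero_le_one.trans hℓ.le)
  have hℓM := Nat.le_ceil ℓ
  have hM0 : 0 < ⌈ℓ⌉₊ := Nat.ceil_pos.mpr (by linarith)
  rw [← hY]
  -- below `4`, one position per message suffices; from `4` on, rounding up both numbers costs at
  -- most a factor `2` each
  rcases lt_or_ge Y 4 with h | h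
  · refine ⟨⌈ℓ⌉₊, 1, hM0, one_pos, hℓM, ?_, ?_⟩
    · push_cast; nlinarith
    · push_cast; nlinarith
  · have hK := Nat.ceil_lt_add_one (show 0 ≤ Y / 4 by linarith)
    have hYK := Nat.le_ceil (Y / 4)
    refine ⟨⌈ℓ⌉₊, ⌈Y / 4⌉₊, hM0, Nat.ceil_pos.mpr (by linarith), hℓM, ?_, ?_⟩
    · rw [hμY]; nlinarith
    · push_cast
      have : (⌈ℓ⌉₊ : ℝ) * ⌈Y / 4⌉₊ ≤ (2 * ℓ) * (Y / 2) := by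
        gcongr <;> linarith
      linarith

/-! ### From entropies to parameters of a code -/

lemma lt_sub_of_lt_sub_sub_sub {a b : EReal} {L c d : ℝ}
    (h : (L : EReal) < a - b - (c : EReal) - (d : EReal)) :
    b < a - ((L + c + d : ℝ) : EReal) := by
  induction a with
  | bot => simp at h
  | top =>
    induction b with
    | top => simp at h
    | bot => rw [EReal.top_sub_coe]; exact bot_lt_top
    | coe b => rw [EReal.top_sub_coe]; exact EReal.coe_lt_top b
  | coe a =>
    induction b with
    | top => simp at h
    | bot => rw [← EReal.coe_sub]; exact EReal.bot_lt_coe _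
    | coe b =>
      norm_cast at h ⊢
      linarith

lemma exists_of_smoothMaxInfo_lt {a b : Type} [Fintype a] [Fintype b] [DecidableEq a]
    [DecidableEq b] {ε : ℝ} {ω : Matrix (a × b) (a × b) ℂ} {s : EReal}
    (h : smoothMaxInfo ε ω < s) : ∃ ω' ∈ stateBall ε ω, ∃ l : ℝ,
      ((((2 : ℝ) ^ l : ℝ) : ℂ) • (traceRight ω ⊗ₖ traceLeft ω') - ω').PosSemidef ∧
        (l : EReal) < s := by
  simpa only [smoothMaxInfo, maxEntropy, iInf_lt_iff, exists_prop] using h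

/-- The infimum defining the hypothesis testing entropy need not be attained, but strict bounds on
the entropy come from an actual test; this covers the infinite value too. -/
lemma exists_test_of_lt_hypTestEntropy {n : Type} [Fintype n] [DecidableEq n] {ε l : ℝ}
    (hε : 0 ≤ ε) {ω τ : Matrix n n ℂ} (hω : IsState ω) (hτ : τ.PosSemidef)
    (h : (l : EReal) < hypTestEntropy ε ω τ) :
    ∃ Λ : Matrix n n ℂ, IsTest Λ ∧ 1 - ε ≤ (Λ * ω).trace.re ∧
      (Λ * τ).trace.re < (2 : ℝ) ^ (-l) := by
  have h0 : 0 ≤ minTypeTwoError ε ω τ := by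
    refine Real.sInf_nonneg ?_
    rintro _ ⟨Λ, hΛ, -, rfl⟩
    exact re_trace_mul_nonneg hΛ.1 hτ
  have hlt : minTypeTwoError ε ω τ < (2 : ℝ) ^ (-l) := by
    rw [hypTestEntropy] at h
    split_ifs at h with hβ
    · rw [hβ]; positivity
    · have hβ' := lt_of_le_of_ne h0 (Ne.symm hβ)
      rw [EReal.coe_lt_coe_iff] at h
      rw [← Real.logb_lt_iff_lt_rpow one_lt_two hβ']
      linarith
  have hne : {x | ∃ Λ : Matrix n n ℂ, IsTest Λ ∧ 1 - ε ≤ (Λ * ω).trace.re ∧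
      x = (Λ * τ).trace.re}.Nonempty :=
    ⟨_, 1, ⟨.one, by simpa using Matrix.PosSemidef.zero⟩, by simpa [hω.2] using hε, rfl⟩
  obtain ⟨_, ⟨Λ, hΛ, hΛω, rfl⟩, hx⟩ := exists_lt_of_csInf_lt hne hlt
  exact ⟨Λ, hΛ, hΛω, hx⟩

end EAPrivate

end

theorem theorem1 {A ι : Type} [Fintype A] [Fintype ι] [DecidableEq ι]
    {d : ι → Type} [∀ i, Fintype (d i)] [∀ i, DecidableEq (d i)]
    (N : EAPrivate.Channel A (∀ i, d i)) (𝓑 𝓔 : Finset ι) (_hcover : 𝓑 ∪ 𝓔 = Finset.univ)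
    (ε δ : ℝ) (hε : ε ∈ Set.Ioo (0 : ℝ) 1) (hδ : δ ∈ Set.Ioo (0 : ℝ) 1) :
    (⨆ (r : ℕ) (ρ : Matrix (Fin r × A) (Fin r × A) ℂ) (_ : EAPrivate.IsState ρ)
        (η₁ ∈ Set.Ioo 0 ε) (η₂ ∈ Set.Ioo 0 δ),
      EAPrivate.hypTestInfo (ε - η₁)
          (EAPrivate.marginal 𝓑 (EAPrivate.tensorId (Fin r) N.map ρ))
        - EAPrivate.smoothMaxInfo (δ - η₂)
          (EAPrivate.marginal 𝓔 (EAPrivate.tensorId (Fin r) N.map ρ))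
        - ((Real.logb 2 (4 * ε / η₁ ^ 2) : ℝ) : EReal)
        - ((2 * Real.logb 2 (1 / η₂) : ℝ) : EReal))
      ≤ EAPrivate.oneShotCapacity N 𝓑 𝓔 ε δ := by
  open EAPrivate in
  refine iSup_le fun r => iSup_le fun ρ => iSup_le fun hρ => iSup₂_le fun η₁ hη₁ =>
    iSup₂_le fun η₂ hη₂ => le_of_not_gt fun hlt => ?_
  -- a real `L` strictly below the bound leaves room for infima that are not attained
  obtain ⟨L, hcap, hL⟩ := EReal.lt_iff_exists_real_btwn.mp hlt
  refine hcap.not_ge ?_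
  have hcode {M : ℕ} (hM : 0 < M) (h : HasCode N 𝓑 𝓔 M ε δ) (hLM : L ≤ Real.logb 2 M) :
      (L : EReal) ≤ oneShotCapacity N 𝓑 𝓔 ε δ :=
    (EReal.coe_le_coe_iff.mpr hLM).trans
      (le_iSup₂ (f := fun (M : ℕ) (_ : 0 < M ∧ HasCode N 𝓑 𝓔 M ε δ) =>
        ((Real.logb 2 M : ℝ) : EReal)) M ⟨hM, h⟩)
  -- a nonpositive rate is achieved by a single message
  rcases le_or_gt L 0 with hL0 | hL0
  · exact hcode one_pos (hasCode_one N 𝓑 𝓔 hε.1.le hδ.1.le hρ) (by simpa using hL0)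
  have hωB := isState_marginal_tensorId N 𝓑 hρ
  have hωE := isState_marginal_tensorId N 𝓔 hρ
  obtain ⟨ω', hω', l, hle, hl⟩ :=
    exists_of_smoothMaxInfo_lt (lt_sub_of_lt_sub_sub_sub hL)
  set c := Real.logb 2 (4 * ε / η₁ ^ 2)
  set e := 2 * Real.logb 2 (1 / η₂) with he
  have hl' := EReal.add_lt_of_lt_sub hl
  rw [← EReal.coe_add] at hl'
  obtain ⟨Λ, hΛ, hΛω, hx⟩ := exists_test_of_lt_hypTestEntropy (sub_nonneg.mpr hη₁.2.le) hωB
    ((posSemidef_traceRight hωB.1).kronecker (posSemidef_traceLeft hωB.1)) hl'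
  have hx0 := re_trace_mul_nonneg hΛ.1
    ((posSemidef_traceRight hωB.1).kronecker (posSemidef_traceLeft hωB.1))
  have hμ := one_le_of_posSemidef_sub (isState_traceRight hωE)
    (re_trace_pos_of_mem_stateBall hωE (by linarith [hη₂.1, hδ.2]) hω') hle
  obtain ⟨M, K, hM, hK, hLM, hKμ, hMK⟩ := exists_block_sizes
    (Real.one_lt_rpow one_lt_two hL0) hμ hη₂.1 (hη₂.2.trans hδ.2)
  have : NeZero M := ⟨hM.ne'⟩
  have : NeZero K := ⟨hK.ne'⟩
  have hη₁0 := hη₁.1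
  have hη₂0 := hη₂.1
  have hε0 := hε.1
  refine hcode hM (hasCode_of_test_of_smoothing N 𝓑 𝓔 hη₁ hδ.2 hη₂.1 hρ hΛ hΛω rfl hω' hle hKμ ?_)
    ((Real.le_logb_iff_rpow_le one_lt_two (by exact_mod_cast hM)).mpr hLM)
  refine (mul_le_mul_of_nonneg_right hMK hx0).trans_lt ?_
  have hpos : 0 < (2 : ℝ) ^ L * (2 ^ l / η₂ ^ 2) := by positivity
  refine (mul_lt_mul_of_pos_left hx hpos).trans_eq ?_
  have h2c : (2 : ℝ) ^ c = 4 * ε / η₁ ^ 2 :=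
    Real.rpow_logb two_pos (by norm_num) (by positivity)
  have h2e : (2 : ℝ) ^ e = 1 / η₂ ^ 2 := by
    rw [he, two_mul, Real.rpow_add two_pos,
      Real.rpow_logb two_pos (by norm_num) (by positivity)]
    field_simp
  rw [Real.rpow_neg two_pos.le, Real.rpow_add two_pos, Real.rpow_add two_pos,
    Real.rpow_add two_pos, h2c, h2e]
  field_simp
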